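/- Let $1\le k\le n$ be integers and let $V$ be a set of $n$ vertices, each holding an opinion in $\{1,\dots,k\}$. The \emph{3-Majority} and \emph{2-Choices} dynamics are the following discrete-time Markov chains $(\mathrm{opn}_t)_{t\ge 0}$ on $\{1,\dots,k\}^V$, started from a given initial configuration $\mathrm{opn}_0$. In each round, all vertices update simultaneously. In 3-Majority, every vertex $v$ selects $w_1,w_2,w_3\in V$ independently and uniformly at random (with replacement, independently over vertices and rounds), and adopts the previous opinion of $w_1$ if $w_1$ and $w_2$ held the same opinion, and that of $w_3$ otherwise. In 2-Choices, every vertex $v$ selects $w_1,w_2\in V$ in the same way, adopts their previous opinion if they held the same one, and keeps its own opinion otherwise. Let $\tau_{\mathrm{cons}}$ be the first round $t\ge 0$ in which all vertices hold the same opinion ($\infty$ if there is none), let $\alpha_0(i)$ be the fraction of vertices that hold opinion $i$ initially, and let $\gamma_0=\sum_{i=1}^k\alpha_0(i)^2$; $\log$ is the natural logarithm. (1) There are universal constants $C,A,B,c>0$ such that, for all $1\le k\le n$, 3-Majority started from any initial configuration with $\gamma_0\ge \frac{C\log n}{\sqrt n}$ satisfies $$\Pr\Bigl[\tau_{\mathrm{cons}}>\frac{A\log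 n}{\gamma_0}\Bigr]\le B\,n^{-c}.$$ (2) There are universal constants $C,A,B,c>0$ such that, for all $1\le k\le n$, 2-Choices started from any initial configuration with $\gamma_0\ge \frac{C(\log n)^2}{n}$ satisfies the same inequality. (3) Consequently, there are universal constants $A,B,c>0$ such that, for every $k=k(n)$ with $k=o(\sqrt n/\log n)$ and all sufficiently large $n$ (depending on the function $k$), 3-Majority with $k$ opinions started from any initial configuration satisfies $\Pr[\tau_{\mathrm{cons}}>A\,k\log n]\le B\,n^{-c}$. (4) Likewise, there are universal constants $A,B,c>0$ such that, for every $k=k(n)$ with $k=o(n/(\log n)^2)$ and all sufficiently large $n$, 2-Choices with $k$ opinions started from any initial configuration satisfies $\Pr[\tau_{\mathrm{cons}}>A\,k\log n]\le B\,n^{-c}$. -/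

import Mathlib

open Filter MeasureTheory ProbabilityTheory
open scoped ENNReal Asymptotics

universe u v

noncomputable section

/-- One round of 3-Majority, given the configuration `x` and, for every vertex `v`, the three
vertices `w v 0`, `w v 1`, `w v 2` that `v` selects. -/
def threeMajorityUpdate {V : Type*} {k : ℕ} (x : V → Fin k) (w : V → Fin 3 → V) : V → Fin k :=
  fun v => if x (w v 0) = x (w v 1) then x (w v 0) else x (w v 2)

/-- One round of 2-Choices, given the configuration `x` and, for every vertex `v`, the two
vertices `w v 0`, `w v 1` that `v` selects. -/
def twoChoicesUpdate {V : Type*} {k : ℕ} (x : V → Fin k) (w : V → Fin 2 → V) : V → Fin k :=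
  fun v => if x (w v 0) = x (w v 1) then x (w v 0) else x v

/-- The one-round transition law of 3-Majority. A uniform element of `V → Fin 3 → V` is the same
as a family of independent uniform elements of `V`, three for each vertex. -/
def threeMajorityStep {V : Type*} [Fintype V] [DecidableEq V] [Nonempty V] {k : ℕ}
    (x : V → Fin k) : PMF (V → Fin k) :=
  (PMF.uniformOfFintype (V → Fin 3 → V)).map (threeMajorityUpdate x)

/-- The one-round transition law of 2-Choices. A uniform element of `V → Fin 2 → V` is the same
as a family of independent uniform elements of `V`, two for each vertex. -/
def twoChoicesStep {V : Type*} [Fintype V] [DecidableEq V] [Nonempty V] {k : ℕ}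
    (x : V → Fin k) : PMF (V → Fin k) :=
  (PMF.uniformOfFintype (V → Fin 2 → V)).map (twoChoicesUpdate x)

/-- `X` is, under `μ`, a time-homogeneous discrete-time Markov chain with transition law `p`
started at the state `x₀` (for a countable discrete state space `S`). -/
structure IsMarkovChainFrom {S Ω : Type*} [MeasurableSpace S] [MeasurableSpace Ω]
    (p : S → PMF S) (x₀ : S) (μ : Measure Ω) (X : ℕ → Ω → S) : Prop where
  measurable : ∀ t, Measurable (X t)
  init : ∀ᵐ ω ∂μ, X 0 ω = x₀
  step : ∀ (t : ℕ) (x : ℕ → S),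
    μ {ω | ∀ s ≤ t + 1, X s ω = x s} = μ {ω | ∀ s ≤ t, X s ω = x s} * p (x t) (x (t + 1))

/-- All vertices support the same opinion. -/
def IsConsensus {V : Type*} {k : ℕ} (x : V → Fin k) : Prop :=
  ∃ i : Fin k, ∀ v : V, x v = i

/-- The consensus time of a trajectory: the first round in which all vertices support the same
opinion (`⊤` if there is none). -/
def consensusTime {V : Type*} {k : ℕ} (opn : ℕ → V → Fin k) : ℕ∞ :=
  ⨅ t ∈ {t : ℕ | IsConsensus (opn t)}, (t : ℕ∞)

/-- The fraction of vertices that support opinion `i`. -/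
def fractionalPopulation {V : Type*} [Fintype V] {k : ℕ} (x : V → Fin k) (i : Fin k) : ℝ :=
  (Finset.univ.filter fun v : V => x v = i).card / Fintype.card V

/-- The squared `ℓ²`-norm of the vector of fractional populations. -/
def gammaNorm {V : Type*} [Fintype V] {k : ℕ} (x : V → Fin k) : ℝ :=
  ∑ i : Fin k, fractionalPopulation x i ^ 2

/-- Every Markov chain with transition law `p` started at `x₀` has consensus time at most `T`,
except with probability at most `δ`. -/
def ConsensusWithin {V : Type u} {k : ℕ} (p : (V → Fin k) → PMF (V → Fin k))
    (x₀ : V → Fin k) (T δ : ℝ) : Prop :=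
  ∀ (Ω : Type v) [MeasurableSpace Ω] (μ : Measure Ω) [IsProbabilityMeasure μ]
    (opn : ℕ → Ω → V → Fin k), IsMarkovChainFrom p x₀ μ opn →
    μ.real {ω | ENNReal.ofReal T < (consensusTime fun t => opn t ω : ℝ≥0∞)} ≤ δ

end

/-! Write `α i` for the population of opinion `i` and `γ` for `gammaNorm`. In both dynamics, given
the current configuration, the vertices update independently and the mean of the next `α i` is `α i
* (1 + α i - γ)`. Hence opinions below `γ` tend to shrink, opinions above it tend to grow, and a
difference `α i - α j` is multiplied in mean by `1 + α i + α j - γ`.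

The proof is divided into stages. In a stage that starts with `γ ≥ g`, consensus or `γ ≥ 6/5 * g` is
reached within `O(log n / g)` rounds, except with probability `4 / n ^ 2`
(`avoid_consensus_or_growth_le_of_log`). The lengths of successive stages are dominated by a
geometric series, so all of them together last `O(log n / γ₀)` rounds; there are at most `5 * n`
stages, hence the failure probability `20 / n` (`avoid_consensus_le`,
`avoid_consensus_le_div_card`).

Within a stage three potentials are used while `γ < 6/5 * g`. (a) `exp (-(n/4) * γ)` is a
supermartingale without any condition, so `γ` is unlikely to fall below `9/10 * g`
(`prodExp_exp_gammaNorm_le`). (b) If some `α i` exceeds `2 * g`, it is unlikely to return below `3/2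
* g`, and above that level `1 / (g ^ 2 + α i ^ 2)` contracts in mean by `1 - g/20`. As this quantity
is bounded below, the stage must end (`avoid_le_of_large`). (c) If all `α i` are at most `2 * g`,
each pair of opinions has the potential `U ^ (3/4) * H ^ (1/4)` with `U = min (α i) (α j) (7/10 *
g)` and `H = 1 / (ε + (α i - α j) ^ 2)`. If one of the two is below `7/10 * g`, its population
shrinks in mean and `U` contracts. Otherwise the difference is pushed away from `0`, by noise when
it is small and by drift when it is large, and `H` contracts (`prodExp_pairPotential_le`). Without
consensus two opinions survive and the sum over pairs is at least `1 / n`; it starts below `n ^ 3`,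
so `O(log n / g)` rounds suffice (`avoid_le_of_pairs`).

The two dynamics differ only in the size of the noise, which `FluctuationBounds` records. The bounds
in terms of `k` follow from `γ₀ ≥ 1 / k`, an instance of Cauchy–Schwarz. -/

noncomputable section

set_option linter.unusedSectionVars false

/-! ### Expectations and moments under finite product laws -/

section ProductLaw

variable {V ι : Type*} [Fintype V] [DecidableEq V] [Fintype ι]

/-- A family of probability vectors on `ι`, one for every `v : V`. -/
structure IsLaw (q : V → ι → ℝ) : Prop where
  nonneg : ∀ v c, 0 ≤ q v c
  sum_eq_one : ∀ v, ∑ c, q v c = 1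

/-- The expectation of `f y`, where the coordinates `y v` are independent with laws `q v`. -/
def prodExp (q : V → ι → ℝ) (f : (V → ι) → ℝ) : ℝ :=
  ∑ y : V → ι, (∏ v, q v (y v)) * f y

variable {q : V → ι → ℝ}

theorem IsLaw.prod_nonneg (hq : IsLaw q) (y : V → ι) : 0 ≤ ∏ v, q v (y v) :=
  Finset.prod_nonneg fun v _ => hq.nonneg v _

theorem IsLaw.le_one (hq : IsLaw q) (v : V) (c : ι) : q v c ≤ 1 := by
  rw [← hq.sum_eq_one v]
  exact Finset.single_le_sum (fun c _ => hq.nonneg v c) (Finset.mem_univ c)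

theorem prodExp_prod (f : V → ι → ℝ) :
    prodExp q (fun y => ∏ v, f v (y v)) = ∏ v, ∑ c, q v c * f v c := by
  rw [Finset.prod_univ_sum]
  simp [prodExp, Finset.prod_mul_distrib]

theorem IsLaw.sum_prod_eq_one (hq : IsLaw q) : ∑ y : V → ι, ∏ v, q v (y v) = 1 := by
  have h := prodExp_prod (q := q) (fun _ _ => (1 : ℝ))
  simpa [prodExp, hq.sum_eq_one] using h

theorem prodExp_const (hq : IsLaw q) (a : ℝ) : prodExp q (fun _ => a) = a := by
  rw [prodExp, ← Finset.sum_mul, hq.sum_prod_eq_one, one_mul]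

theorem prodExp_add (f g : (V → ι) → ℝ) :
    prodExp q (fun y => f y + g y) = prodExp q f + prodExp q g := by
  simp [prodExp, mul_add, Finset.sum_add_distrib]

theorem prodExp_const_mul (a : ℝ) (f : (V → ι) → ℝ) :
    prodExp q (fun y => a * f y) = a * prodExp q f := by
  simp only [prodExp, Finset.mul_sum]
  exact Finset.sum_congr rfl fun y _ => by ring

theorem prodExp_sum {κ : Type*} (s : Finset κ) (f : κ → (V → ι) → ℝ) :
    prodExp q (fun y => ∑ j ∈ s, f j y) = ∑ j ∈ s, prodExp q (f j) := by
  simp only [prodExp, Finset.mul_sum]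
  exact Finset.sum_comm

theorem prodExp_mono (hq : IsLaw q) {f g : (V → ι) → ℝ} (h : ∀ y, f y ≤ g y) :
    prodExp q f ≤ prodExp q g :=
  Finset.sum_le_sum fun y _ => mul_le_mul_of_nonneg_left (h y) (hq.prod_nonneg y)

theorem prodExp_nonneg (hq : IsLaw q) {f : (V → ι) → ℝ} (h : ∀ y, 0 ≤ f y) : 0 ≤ prodExp q f :=
  Finset.sum_nonneg fun y _ => mul_nonneg (hq.prod_nonneg y) (h y)

theorem prod_update_mul (v : V) (y : V → ι) (c : ι) :
    (∏ w, q w (Function.update y v c w)) * q v (y v) = (∏ w, q w (y w)) * q v c := by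
  rw [Fintype.prod_eq_mul_prod_compl v, Fintype.prod_eq_mul_prod_compl v (fun w => q w (y w))]
  have : ∏ w ∈ {v}ᶜ, q w (Function.update y v c w) = ∏ w ∈ {v}ᶜ, q w (y w) := by
    refine Finset.prod_congr rfl fun w hw => ?_
    rw [Function.update_of_ne (by simpa using hw)]
  rw [this, Function.update_self]
  ring

/-- Resampling one coordinate does not change expectations. -/
theorem prodExp_resample (hq : IsLaw q) (v : V) (f : (V → ι) → ℝ) :
    prodExp q f = prodExp q (fun y => ∑ c, q v c * f (Function.update y v c)) := by
  have hL : prodExp q f = ∑ p : (V → ι) × ι, (∏ w, q w (p.1 w)) * f p.1 * q v p.2 := by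
    rw [Fintype.sum_prod_type]
    simp only [← Finset.mul_sum, hq.sum_eq_one, mul_one, prodExp]
  have hR : prodExp q (fun y => ∑ c, q v c * f (Function.update y v c)) =
      ∑ p : (V → ι) × ι, (∏ w, q w (p.1 w)) * (q v p.2 * f (Function.update p.1 v p.2)) := by
    rw [Fintype.sum_prod_type]
    simp only [prodExp, Finset.mul_sum]
  rw [hL, hR]
  -- Exchanging `y v` with the fresh sample `c` is an involution on pairs `(y, c)` that preserves
  -- their joint law.
  refine Finset.sum_nbij' (fun p => (Function.update p.1 v p.2, p.1 v))
    (fun p => (Function.update p.1 v p.2, p.1 v)) (by simp) (by simp) ?_ ?_ ?_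
  · intro p _; simp
  · intro p _; simp
  · intro p _
    have := prod_update_mul (q := q) v p.1 p.2
    simp only [Function.update_idem, Function.update_eq_self]
    linear_combination (-f p.1) * this

theorem prodExp_coord (hq : IsLaw q) (v : V) (h : ι → ℝ) :
    prodExp q (fun y => h (y v)) = ∑ c, q v c * h c := by
  rw [prodExp_resample hq v]
  simp [prodExp_const hq]

theorem prodExp_indep (hq : IsLaw q) {s : Finset V} {v : V} (hv : v ∉ s) (ζ : V → ι → ℝ)
    (F : ℝ → ℝ) (h : ι → ℝ) :
    prodExp q (fun y => F (∑ w ∈ s, ζ w (y w)) * h (y v)) =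
      prodExp q (fun y => F (∑ w ∈ s, ζ w (y w))) * ∑ c, q v c * h c := by
  rw [prodExp_resample hq v, mul_comm, ← prodExp_const_mul]
  congr 1
  funext y
  rw [Finset.sum_mul]
  refine Finset.sum_congr rfl fun c _ => ?_
  have : ∑ w ∈ s, ζ w (Function.update y v c w) = ∑ w ∈ s, ζ w (y w) :=
    Finset.sum_congr rfl fun w hw => by
      rw [Function.update_of_ne]; rintro rfl; exact hv hw
  rw [this, Function.update_self]
  ring

section Moments

variable {ζ : V → ι → ℝ}

theorem prodExp_sum_centered (hq : IsLaw q) (h0 : ∀ v, ∑ c, q v c * ζ v c = 0) (s : Finset V) :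
    prodExp q (fun y => ∑ w ∈ s, ζ w (y w)) = 0 := by
  rw [prodExp_sum]
  exact Finset.sum_eq_zero fun v _ => by rw [prodExp_coord hq v (ζ v), h0]

theorem prodExp_sum_sq (hq : IsLaw q) (h0 : ∀ v, ∑ c, q v c * ζ v c = 0) (s : Finset V) :
    prodExp q (fun y => (∑ w ∈ s, ζ w (y w)) ^ 2) = ∑ w ∈ s, ∑ c, q w c * ζ w c ^ 2 := by
  induction s using Finset.induction_on with
  | empty => simp [prodExp_const hq]
  | insert v s hv ih =>
    have e : (fun y : V → ι => (∑ w ∈ insert v s, ζ w (y w)) ^ 2) = fun y =>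
        (∑ w ∈ s, ζ w (y w)) ^ 2 + (2 * ((fun t => t) (∑ w ∈ s, ζ w (y w)) * ζ v (y v))
          + ζ v (y v) ^ 2) := by
      funext y; rw [Finset.sum_insert hv]; ring
    rw [e, prodExp_add, prodExp_add, prodExp_const_mul, prodExp_indep hq hv ζ (fun t => t) (ζ v),
      h0, ih, prodExp_coord hq v (fun c => ζ v c ^ 2), Finset.sum_insert hv]
    ring

theorem prodExp_sum_pow_four_le (hq : IsLaw q) (h0 : ∀ v, ∑ c, q v c * ζ v c = 0) {b : ℝ}
    (hb : ∀ v c, |ζ v c| ≤ b) (s : Finset V) :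
    prodExp q (fun y => (∑ w ∈ s, ζ w (y w)) ^ 4) ≤
      3 * (∑ w ∈ s, ∑ c, q w c * ζ w c ^ 2) ^ 2 + b ^ 2 * ∑ w ∈ s, ∑ c, q w c * ζ w c ^ 2 := by
  induction s using Finset.induction_on with
  | empty => simp [prodExp_const hq]
  | insert v s hv ih =>
    have e : (fun y : V → ι => (∑ w ∈ insert v s, ζ w (y w)) ^ 4) = fun y =>
        (∑ w ∈ s, ζ w (y w)) ^ 4 + (4 * ((fun t => t ^ 3) (∑ w ∈ s, ζ w (y w)) * ζ v (y v))
          + (6 * ((fun t => t ^ 2) (∑ w ∈ s, ζ w (y w)) * (fun c => ζ v c ^ 2) (y v))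
          + (4 * ((fun t => t) (∑ w ∈ s, ζ w (y w)) * (fun c => ζ v c ^ 3) (y v))
          + ζ v (y v) ^ 4))) := by
      funext y; rw [Finset.sum_insert hv]; ring
    have h4 : ∑ c, q v c * ζ v c ^ 4 ≤ b ^ 2 * ∑ c, q v c * ζ v c ^ 2 := by
      rw [Finset.mul_sum]
      refine Finset.sum_le_sum fun c _ => ?_
      have h1 : ζ v c ^ 2 ≤ b ^ 2 := sq_le_sq' (abs_le.1 (hb v c)).1 (abs_le.1 (hb v c)).2
      have h2 := mul_nonneg (hq.nonneg v c) (sq_nonneg (ζ v c))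
      nlinarith [mul_le_mul_of_nonneg_left h1 h2]
    rw [e, prodExp_add, prodExp_add, prodExp_add, prodExp_add, prodExp_const_mul, prodExp_const_mul,
      prodExp_const_mul, prodExp_indep hq hv ζ (fun t => t ^ 3) (ζ v), h0,
      prodExp_indep hq hv ζ (fun t => t ^ 2) (fun c => ζ v c ^ 2),
      prodExp_indep hq hv ζ (fun t => t) (fun c => ζ v c ^ 3),
      prodExp_sum_centered hq h0, prodExp_sum_sq hq h0, prodExp_coord hq v (fun c => ζ v c ^ 4),
      Finset.sum_insert hv]
    nlinarith [sq_nonneg (∑ c, q v c * ζ v c ^ 2)]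

end Moments

/-- Second-order expansion of `1 / (A + w)` at `A = ε + m ^ 2` with `w = 2 * m * z + z ^ 2`. The
exact remainder `w ^ 2 / (A ^ 2 * (A + w))` is bounded by terms in `z ^ 2` and `z ^ 4`, so only
second and fourth moments of the noise `z` are needed. -/
theorem inv_add_sq_le {ε m z : ℝ} (hε : 0 < ε) :
    1 / (ε + (m + z) ^ 2) ≤ 1 / (ε + m ^ 2) - (2 * m * z + z ^ 2) / (ε + m ^ 2) ^ 2 +
      (32 * (m ^ 2 / (ε + m ^ 2)) * z ^ 2 + 34 * z ^ 4 / ε) / (ε + m ^ 2) ^ 2 := by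
  set A := ε + m ^ 2 with hA
  have hA0 : 0 < A := by positivity
  have hB0 : 0 < ε + (m + z) ^ 2 := by positivity
  have key : z ^ 2 * (2 * m + z) ^ 2 / (ε + (m + z) ^ 2) ≤
      32 * (m ^ 2 / A) * z ^ 2 + 34 * z ^ 4 / ε := by
    have h1 : z ^ 2 * (2 * m + z) ^ 2 / (ε + (m + z) ^ 2) ≤
        8 * m ^ 2 * z ^ 2 / (ε + (m + z) ^ 2) + 2 * z ^ 4 / ε := by
      have h2 : 2 * z ^ 4 / (ε + (m + z) ^ 2) ≤ 2 * z ^ 4 / ε := by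
        gcongr; nlinarith [sq_nonneg (m + z)]
      calc _ ≤ (8 * m ^ 2 * z ^ 2 + 2 * z ^ 4) / (ε + (m + z) ^ 2) := by
            gcongr; nlinarith [mul_nonneg (sq_nonneg z) (sq_nonneg (2 * m - z))]
        _ ≤ _ := by rw [add_div]; linarith
    -- If `|z| ≤ |m| / 2`, the denominator is at least `A / 4`; otherwise `m ^ 2 * z ^ 2` is
    -- absorbed by `z ^ 4` and the denominator is bounded below by `ε`.
    rcases le_total (4 * z ^ 2) (m ^ 2) with h | h
    · have h3 : 8 * m ^ 2 * z ^ 2 / (ε + (m + z) ^ 2) ≤ 8 * m ^ 2 * z ^ 2 / (A / 4) := by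
        gcongr
        nlinarith [sq_nonneg (m + 2 * z), sq_nonneg (m+4*z)]
      have h4 : 8 * m ^ 2 * z ^ 2 / (A / 4) = 32 * (m ^ 2 / A) * z ^ 2 := by field_simp; ring
      have h5 : 2 * z ^ 4 / ε ≤ 34 * z ^ 4 / ε := by gcongr; norm_num
      linarith
    · have h3 : 8 * m ^ 2 * z ^ 2 / (ε + (m + z) ^ 2) ≤ 32 * z ^ 4 / ε :=
        div_le_div₀ (by positivity) (by nlinarith [mul_le_mul_of_nonneg_right h (sq_nonneg z)]) hε
          (by nlinarith [sq_nonneg (m + z)])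
      have h4 : 34 * z ^ 4 / ε = 32 * z ^ 4 / ε + 2 * z ^ 4 / ε := by ring
      have h5 : 0 ≤ 32 * (m ^ 2 / A) * z ^ 2 := by positivity
      linarith
  have e : 1 / (ε + (m + z) ^ 2) = 1 / A - (2 * m * z + z ^ 2) / A ^ 2 +
      (z ^ 2 * (2 * m + z) ^ 2 / (ε + (m + z) ^ 2)) / A ^ 2 := by
    have : ε = A - m ^ 2 := by rw [hA]; ring
    have hB0' : A - m ^ 2 + (m + z) ^ 2 ≠ 0 := by rw [← this]; exact hB0.ne'
    rw [this]
    field_simp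
    ring
  rw [e]
  gcongr

/-- A bound for `E[1 / (ε + X²)]`, where `X` is a sum of independent random variables. -/
theorem prodExp_inv_add_sq_le (hq : IsLaw q) (f : V → ι → ℝ) {ε b m σ : ℝ} (hε : 0 < ε)
    (hb : ∀ v c, |f v c - ∑ c, q v c * f v c| ≤ b) (hm : m = ∑ v, ∑ c, q v c * f v c)
    (hσ : σ = ∑ v, ((∑ c, q v c * f v c ^ 2) - (∑ c, q v c * f v c) ^ 2)) :
    prodExp q (fun y => 1 / (ε + (∑ v, f v (y v)) ^ 2)) ≤
      1 / (ε + m ^ 2) * (1 - σ / (ε + m ^ 2) * (1 - 32 * (m ^ 2 / (ε + m ^ 2)))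
        + 34 * (σ * (3 * σ + b ^ 2)) / (ε * (ε + m ^ 2))) := by
  set ζ : V → ι → ℝ := fun v c => f v c - ∑ c, q v c * f v c with hζ
  have h0 : ∀ v, ∑ c, q v c * ζ v c = 0 := fun v => by
    simp only [hζ, mul_sub, Finset.sum_sub_distrib, ← Finset.sum_mul, hq.sum_eq_one]; ring
  have h2 : ∀ v, ∑ c, q v c * ζ v c ^ 2 =
      (∑ c, q v c * f v c ^ 2) - (∑ c, q v c * f v c) ^ 2 := fun v => by
    set M := ∑ c, q v c * f v c with hM
    have : ∀ c, q v c * ζ v c ^ 2 = q v c * f v c ^ 2 - 2 * M * (q v c * f v c) + M ^ 2 * q v c := by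
      intro c; simp only [hζ, ← hM]; ring
    simp only [this, Finset.sum_add_distrib, Finset.sum_sub_distrib, ← Finset.mul_sum,
      hq.sum_eq_one, ← hM]
    ring
  have hσ2 : σ = ∑ v, ∑ c, q v c * ζ v c ^ 2 := by rw [hσ]; exact Finset.sum_congr rfl fun v _ => (h2 v).symm
  have hX : ∀ y : V → ι, ∑ v, f v (y v) = m + ∑ v, ζ v (y v) := fun y => by
    simp only [hζ, Finset.sum_sub_distrib, hm]; ring
  set A := ε + m ^ 2 with hA
  have hA0 : 0 < A := by positivity
  have step : prodExp q (fun y => 1 / (ε + (∑ v, f v (y v)) ^ 2)) ≤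
      prodExp q (fun y => 1 / A + ((-(2 * m) / A ^ 2) * (∑ v, ζ v (y v)) +
        (((32 * (m ^ 2 / A) - 1) / A ^ 2) * (∑ v, ζ v (y v)) ^ 2 +
          (34 / ε / A ^ 2) * (∑ v, ζ v (y v)) ^ 4))) := by
    refine prodExp_mono hq fun y => ?_
    rw [hX]
    refine (inv_add_sq_le hε).trans (le_of_eq ?_)
    rw [← hA]
    ring
  refine step.trans ?_
  rw [prodExp_add, prodExp_add, prodExp_add, prodExp_const hq, prodExp_const_mul, prodExp_const_mul,
    prodExp_const_mul, prodExp_sum_centered hq h0, prodExp_sum_sq hq h0, ← hσ2]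
  have h4 := prodExp_sum_pow_four_le hq h0 hb Finset.univ
  rw [← hσ2] at h4
  have h5 := mul_le_mul_of_nonneg_left h4 (by positivity : 0 ≤ 34 / ε / A ^ 2)
  refine (add_le_add_right (add_le_add_right (add_le_add_right h5 _) _) _).trans (le_of_eq ?_)
  field_simp
  ring

/-- A bound for the Laplace transform of a sum of independent random variables. -/
theorem prodExp_exp_neg_sum_le (hq : IsLaw q) (f : V → ι → ℝ) {u : ℝ}
    (hf : ∀ v c, |u * f v c| ≤ 1) :
    prodExp q (fun y => Real.exp (-(u * ∑ v, f v (y v)))) ≤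
      Real.exp (-(u * ∑ v, ∑ c, q v c * f v c) + u ^ 2 * ∑ v, ∑ c, q v c * f v c ^ 2) := by
  have e : (fun y : V → ι => Real.exp (-(u * ∑ v, f v (y v)))) =
      fun y => ∏ v, Real.exp (-(u * f v (y v))) := by
    funext y; rw [← Real.exp_sum, Finset.mul_sum, Finset.sum_neg_distrib]
  rw [e, prodExp_prod (fun v c => Real.exp (-(u * f v c))), Finset.mul_sum, Finset.mul_sum,
    ← Finset.sum_neg_distrib, ← Finset.sum_add_distrib, Real.exp_sum]
  refine Finset.prod_le_prod (fun v _ => Finset.sum_nonneg fun c _ =>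
    mul_nonneg (hq.nonneg v c) (Real.exp_pos _).le) fun v _ => ?_
  have h1 : ∑ c, q v c * Real.exp (-(u * f v c)) ≤
      ∑ c, q v c * (1 - u * f v c + (u * f v c) ^ 2) := by
    refine Finset.sum_le_sum fun c _ => mul_le_mul_of_nonneg_left ?_ (hq.nonneg v c)
    have := Real.abs_exp_sub_one_sub_id_le (x := -(u * f v c)) (by rw [abs_neg]; exact hf v c)
    have := (abs_le.1 this).2
    nlinarith
  have h2 : ∑ c, q v c * (1 - u * f v c + (u * f v c) ^ 2) =
      1 + (-(u * ∑ c, q v c * f v c) + u ^ 2 * ∑ c, q v c * f v c ^ 2) := by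
    have : ∀ c, q v c * (1 - u * f v c + (u * f v c) ^ 2) =
      q v c + (-(u * (q v c * f v c)) + u ^ 2 * (q v c * f v c ^ 2)) := fun c => by ring
    simp only [this, Finset.sum_add_distrib, Finset.sum_neg_distrib, ← Finset.mul_sum, hq.sum_eq_one]
  rw [h2] at h1
  refine h1.trans ?_
  have := Real.add_one_le_exp (-(u * ∑ c, q v c * f v c) + u ^ 2 * ∑ c, q v c * f v c ^ 2)
  linarith

end ProductLaw

/-! ### Avoidance probabilities of a finite chain -/

section Avoid

variable {S : Type*} [Fintype S]

/-- A stochastic matrix. -/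
structure IsStochastic (K : S → S → ℝ) : Prop where
  nonneg : ∀ x y, 0 ≤ K x y
  sum_eq_one : ∀ x, ∑ y, K x y = 1

open Classical in
/-- The probability that the chain with transition matrix `K` started at `x` does not visit `D`
in the rounds `0, …, t`. -/
def avoid (K : S → S → ℝ) (D : S → Prop) : ℕ → S → ℝ
  | 0, x => if D x then 0 else 1
  | t + 1, x => if D x then 0 else ∑ y, K x y * avoid K D t y

variable {K : S → S → ℝ} {D : S → Prop}

theorem avoid_of_mem {x : S} (h : D x) (t : ℕ) : avoid K D t x = 0 := by
  cases t <;> simp [avoid, h]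

theorem avoid_zero {x : S} (h : ¬ D x) : avoid K D 0 x = 1 := by simp [avoid, h]

theorem avoid_succ {x : S} (h : ¬ D x) (t : ℕ) :
    avoid K D (t + 1) x = ∑ y, K x y * avoid K D t y := by simp [avoid, h]

theorem IsStochastic.sum_mul_mono (hK : IsStochastic K) (x : S) {f g : S → ℝ}
    (h : ∀ y, f y ≤ g y) : ∑ y, K x y * f y ≤ ∑ y, K x y * g y :=
  Finset.sum_le_sum fun y _ => mul_le_mul_of_nonneg_left (h y) (hK.nonneg x y)

theorem IsStochastic.sum_mul_const (hK : IsStochastic K) (x : S) (a : ℝ) :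
    ∑ y, K x y * a = a := by
  rw [← Finset.sum_mul, hK.sum_eq_one, one_mul]

theorem avoid_nonneg (hK : IsStochastic K) (t : ℕ) (x : S) : 0 ≤ avoid K D t x := by
  induction t generalizing x with
  | zero => by_cases h : D x <;> simp [avoid, h]
  | succ t ih =>
    by_cases h : D x
    · rw [avoid_of_mem h]
    · rw [avoid_succ h]
      exact Finset.sum_nonneg fun y _ => mul_nonneg (hK.nonneg x y) (ih y)

theorem avoid_le_one (hK : IsStochastic K) (t : ℕ) (x : S) : avoid K D t x ≤ 1 := by
  induction t generalizing x with
  | zero => by_cases h : D x <;> simp [avoid, h]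
  | succ t ih =>
    by_cases h : D x
    · rw [avoid_of_mem h]; exact zero_le_one
    · rw [avoid_succ h]
      exact (hK.sum_mul_mono x ih).trans (hK.sum_mul_const x 1).le

theorem avoid_antitone (hK : IsStochastic K) (x : S) : Antitone fun t => avoid K D t x := by
  refine antitone_nat_of_succ_le fun t => ?_
  induction t generalizing x with
  | zero =>
    by_cases h : D x
    · rw [avoid_of_mem h, avoid_of_mem h]
    · rw [avoid_zero h]; exact avoid_le_one hK _ x
  | succ t ih =>
    by_cases h : D x
    · rw [avoid_of_mem h, avoid_of_mem h]
    · rw [avoid_succ h, avoid_succ h]; exact hK.sum_mul_mono x ih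

/-- Markov's inequality for a potential that shrinks in mean by `r` until `D` is reached and is at
least `φ` off `D`. -/
theorem mul_avoid_le_of_contraction (hK : IsStochastic K) {Φ : S → ℝ} {r φ : ℝ} (hr : 0 ≤ r)
    (hΦ : ∀ x, 0 ≤ Φ x) (hφ : ∀ x, ¬ D x → φ ≤ Φ x)
    (h : ∀ x, ¬ D x → ∑ y, K x y * Φ y ≤ r * Φ x) (t : ℕ) (x : S) :
    φ * avoid K D t x ≤ r ^ t * Φ x := by
  induction t generalizing x with
  | zero =>
    by_cases hx : D x
    · rw [avoid_of_mem hx]; simpa using hΦ x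
    · rw [avoid_zero hx]; simpa using hφ x hx
  | succ t ih =>
    by_cases hx : D x
    · rw [avoid_of_mem hx, mul_zero]; exact mul_nonneg (pow_nonneg hr _) (hΦ x)
    · rw [avoid_succ hx, Finset.mul_sum]
      calc ∑ y, φ * (K x y * avoid K D t y) = ∑ y, K x y * (φ * avoid K D t y) :=
            Finset.sum_congr rfl fun y _ => by ring
        _ ≤ ∑ y, K x y * (r ^ t * Φ y) := hK.sum_mul_mono x ih
        _ = r ^ t * ∑ y, K x y * Φ y := by
            rw [Finset.mul_sum]; exact Finset.sum_congr rfl fun y _ => by ring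
        _ ≤ r ^ t * (r * Φ x) := mul_le_mul_of_nonneg_left (h x hx) (pow_nonneg hr t)
        _ = r ^ (t + 1) * Φ x := by ring

/-- Optional stopping: `h` is a supermartingale until the chain enters `D` or `B` and is at least
`1` on `B`, so `h x` bounds the probability of entering `B` before `D`. Thus `B` can be added to the
target at cost `h x`. -/
theorem avoid_le_avoid_or_add (hK : IsStochastic K) {B : S → Prop} {h : S → ℝ}
    (h0 : ∀ x, 0 ≤ h x) (hB : ∀ x, B x → 1 ≤ h x)
    (hh : ∀ x, ¬ D x → ¬ B x → ∑ y, K x y * h y ≤ h x) (t : ℕ) (x : S) :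
    avoid K D t x ≤ avoid K (fun x => D x ∨ B x) t x + h x := by
  induction t generalizing x with
  | zero =>
    by_cases hx : D x
    · rw [avoid_of_mem hx, avoid_of_mem (D := fun x => D x ∨ B x) (Or.inl hx)]; simpa using h0 x
    by_cases hx' : B x
    · have := hB x hx'
      have := avoid_le_one (D := D) hK 0 x
      have := avoid_nonneg (D := fun x => D x ∨ B x) hK 0 x
      linarith
    · rw [avoid_zero hx, avoid_zero (by tauto)]; linarith [h0 x]
  | succ t ih =>
    by_cases hx : D x
    · rw [avoid_of_mem hx, avoid_of_mem (D := fun x => D x ∨ B x) (Or.inl hx)]; simpa using h0 x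
    by_cases hx' : B x
    · have := hB x hx'
      have := avoid_le_one (D := D) hK (t + 1) x
      have := avoid_nonneg (D := fun x => D x ∨ B x) hK (t + 1) x
      linarith
    · rw [avoid_succ hx, avoid_succ (by tauto)]
      refine (hK.sum_mul_mono x ih).trans ?_
      simp only [mul_add, Finset.sum_add_distrib]
      linarith [hh x hx hx']

/-- The Markov property at the first visit to `G`: either `D ∨ G` is avoided for `t₁` rounds, or at
least `t₂` rounds remain after entering `G`. -/
theorem avoid_add_le (hK : IsStochastic K) {G : S → Prop} {δ : ℝ} (hδ : 0 ≤ δ) {t₂ : ℕ}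
    (h : ∀ y, ¬ D y → G y → avoid K D t₂ y ≤ δ) (t₁ : ℕ) (x : S) :
    avoid K D (t₁ + t₂) x ≤ avoid K (fun x => D x ∨ G x) t₁ x + δ := by
  induction t₁ generalizing x with
  | zero =>
    by_cases hx : D x
    · rw [avoid_of_mem hx, avoid_of_mem (D := fun x => D x ∨ G x) (Or.inl hx)]; simpa using hδ
    by_cases hx' : G x
    · rw [avoid_of_mem (D := fun x => D x ∨ G x) (Or.inr hx'), zero_add, zero_add]
      exact h x hx hx'
    · rw [avoid_zero (D := fun x => D x ∨ G x) (by tauto)]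
      linarith [avoid_le_one (D := D) hK (0 + t₂) x]
  | succ t ih =>
    by_cases hx : D x
    · rw [avoid_of_mem hx, avoid_of_mem (D := fun x => D x ∨ G x) (Or.inl hx)]; simpa using hδ
    by_cases hx' : G x
    · rw [avoid_of_mem (D := fun x => D x ∨ G x) (Or.inr hx'), zero_add]
      exact (avoid_antitone hK x (by omega)).trans (h x hx hx')
    · rw [show t + 1 + t₂ = (t + t₂) + 1 by omega, avoid_succ hx,
        avoid_succ (D := fun x => D x ∨ G x) (by tauto)]
      refine (hK.sum_mul_mono x ih).trans ?_
      simp only [mul_add, Finset.sum_add_distrib]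
      rw [hK.sum_mul_const]

end Avoid

/-! ### From trajectories to avoidance probabilities -/

section Trajectories

variable {S : Type*} [Fintype S] {Ω : Type*} [MeasurableSpace S] [MeasurableSpace Ω]

theorem isStochastic_toReal (p : S → PMF S) : IsStochastic fun x y => (p x y).toReal where
  nonneg _ _ := ENNReal.toReal_nonneg
  sum_eq_one x := by
    rw [← ENNReal.toReal_sum fun y _ => (p x).apply_ne_top y, ← tsum_fintype (L := SummationFilter.unconditional S), (p x).tsum_coe]
    rfl

/-- Induction on `m`, splitting according to the state at time `t + 1`. Conditioning on the whole
prefix is what makes the `step` field of the chain applicable. -/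
theorem IsMarkovChainFrom.measure_prefix_avoid_le {p : S → PMF S} {x₀ : S} {μ : Measure Ω}
    {X : ℕ → Ω → S} (hX : IsMarkovChainFrom p x₀ μ X) (D : S → Prop) (m t : ℕ) (x : ℕ → S) :
    μ {ω | (∀ s ≤ t, X s ω = x s) ∧ ∀ s, t ≤ s → s ≤ t + m → ¬ D (X s ω)} ≤
      μ {ω | ∀ s ≤ t, X s ω = x s} *
        ENNReal.ofReal (avoid (fun x y => (p x y).toReal) D m (x t)) := by
  have hK := isStochastic_toReal p
  induction m generalizing t x with
  | zero =>
    by_cases hx : D (x t)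
    · rw [avoid_of_mem hx]
      refine le_of_eq_of_le (measure_mono_null (fun ω hω => ?_) measure_empty) zero_le
      exact hω.2 t le_rfl le_rfl ((hω.1 t le_rfl).symm ▸ hx)
    · rw [avoid_zero hx, ENNReal.ofReal_one, mul_one]
      exact measure_mono fun ω hω => hω.1
  | succ m ih =>
    by_cases hx : D (x t)
    · rw [avoid_of_mem hx]
      refine le_of_eq_of_le (measure_mono_null (fun ω hω => ?_) measure_empty) zero_le
      exact hω.2 t le_rfl (by omega) ((hω.1 t le_rfl).symm ▸ hx)
    · rw [avoid_succ hx]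
      let x' : S → ℕ → S := fun y => Function.update x (t + 1) y
      have hpre : ∀ y, {ω | ∀ s ≤ t, X s ω = x' y s} = {ω | ∀ s ≤ t, X s ω = x s} := by
        intro y
        ext ω
        refine forall₂_congr fun s hs => ?_
        simp only [x']
        rw [Function.update_of_ne (by omega)]
      have hsub : {ω | (∀ s ≤ t, X s ω = x s) ∧ ∀ s, t ≤ s → s ≤ t + (m + 1) → ¬ D (X s ω)} ⊆
          ⋃ y, {ω | (∀ s ≤ t + 1, X s ω = x' y s) ∧
            ∀ s, t + 1 ≤ s → s ≤ t + 1 + m → ¬ D (X s ω)} := by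
        intro ω hω
        rw [Set.mem_iUnion]
        refine ⟨X (t + 1) ω, fun s hs => ?_, fun s h1 h2 => hω.2 s (by omega) (by omega)⟩
        rcases eq_or_ne s (t + 1) with rfl | h
        · simp [x']
        · simp only [x']
          rw [Function.update_of_ne h]
          exact hω.1 s (by omega)
      refine (measure_mono hsub).trans ((measure_iUnion_fintype_le μ _).trans ?_)
      rw [ENNReal.ofReal_sum_of_nonneg fun y _ => mul_nonneg (hK.nonneg _ _) (avoid_nonneg hK _ _),
        Finset.mul_sum]
      refine Finset.sum_le_sum fun y _ => (ih (t + 1) (x' y)).trans (le_of_eq ?_)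
      have h1 : x' y (t + 1) = y := by simp [x']
      have h2 : x' y t = x t := by simp only [x']; rw [Function.update_of_ne (by omega)]
      rw [hX.step t (x' y), hpre, h1, h2, ENNReal.ofReal_mul ENNReal.toReal_nonneg,
        ENNReal.ofReal_toReal ((p (x t)).apply_ne_top y), mul_assoc]

end Trajectories

theorem consensusWithin_of_avoid_le {V : Type u} [Fintype V] [DecidableEq V] {k : ℕ}
    {p : (V → Fin k) → PMF (V → Fin k)} {x₀ : V → Fin k} {T δ : ℝ} {t : ℕ} (ht : (t : ℝ) ≤ T)
    (h : avoid (fun x y => (p x y).toReal) IsConsensus t x₀ ≤ δ) :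
    ConsensusWithin.{u, v} p x₀ T δ := by
  intro Ω _ μ _ X hX
  have h1 := hX.measure_prefix_avoid_le IsConsensus t 0 (fun _ => x₀)
  refine le_trans ?_ h
  rw [Measure.real]
  refine ENNReal.toReal_le_of_le_ofReal (avoid_nonneg (isStochastic_toReal p) _ _) ?_
  refine le_trans ?_ (h1.trans (mul_le_of_le_one_left zero_le prob_le_one))
  refine measure_mono_ae ?_
  filter_upwards [hX.init] with ω hω hlt
  refine ⟨fun s hs => by rwa [Nat.le_zero.1 hs], fun s _ hs hcons => ?_⟩
  have h2 : consensusTime (fun t => X t ω) ≤ (s : ℕ∞) := by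
    unfold consensusTime
    exact iInf₂_le s hcons
  have h3 : ((consensusTime fun t => X t ω : ℕ∞) : ℝ≥0∞) ≤ (s : ℝ≥0∞) := by exact_mod_cast h2
  have h4 : (s : ℝ≥0∞) ≤ ENNReal.ofReal T := by
    rw [← ENNReal.ofReal_natCast]
    refine ENNReal.ofReal_le_ofReal (le_trans ?_ ht)
    exact_mod_cast (by omega : s ≤ t)
  have h5 : ENNReal.ofReal T < ((consensusTime fun t => X t ω : ℕ∞) : ℝ≥0∞) := hlt
  exact absurd (h3.trans h4) (not_le.2 h5)

/-! ### Fractional populations and their squared norm -/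

section Population

variable {V : Type*} [Fintype V] {k : ℕ}

theorem fractionalPopulation_nonneg (x : V → Fin k) (i : Fin k) : 0 ≤ fractionalPopulation x i := by
  unfold fractionalPopulation; positivity

theorem fractionalPopulation_eq_sum (x : V → Fin k) (i : Fin k) :
    fractionalPopulation x i = ∑ v, (if x v = i then 1 else 0) / (Fintype.card V : ℝ) := by
  rw [← Finset.sum_div, Finset.sum_boole]; rfl

theorem sum_comp_eq_card_mul [Nonempty V] (x : V → Fin k) (f : Fin k → ℝ) :
    ∑ v, f (x v) = Fintype.card V * ∑ i, fractionalPopulation x i * f i := by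
  have hn : (Fintype.card V : ℝ) ≠ 0 := by exact_mod_cast Fintype.card_ne_zero
  have : ∀ v, f (x v) = ∑ i, (if x v = i then 1 else 0) * f i := fun v => by simp
  simp only [this]
  rw [Finset.sum_comm, Finset.mul_sum]
  refine Finset.sum_congr rfl fun i _ => ?_
  rw [← Finset.sum_mul, Finset.sum_boole, fractionalPopulation]
  field_simp

theorem sum_fractionalPopulation [Nonempty V] (x : V → Fin k) :
    ∑ i, fractionalPopulation x i = 1 := by
  have hn : (Fintype.card V : ℝ) ≠ 0 := by exact_mod_cast Fintype.card_ne_zero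
  have h := sum_comp_eq_card_mul x (fun _ => (1 : ℝ))
  simp only [Finset.sum_const, Finset.card_univ, nsmul_eq_mul, mul_one] at h
  exact (mul_eq_left₀ hn).1 h.symm

theorem fractionalPopulation_le_one [Nonempty V] (x : V → Fin k) (i : Fin k) :
    fractionalPopulation x i ≤ 1 := by
  rw [← sum_fractionalPopulation x]
  exact Finset.single_le_sum (fun i _ => fractionalPopulation_nonneg x i) (Finset.mem_univ i)

theorem fractionalPopulation_add_le_one [Nonempty V] (x : V → Fin k) {i j : Fin k} (h : i ≠ j) :
    fractionalPopulation x i + fractionalPopulation x j ≤ 1 := by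
  rw [← sum_fractionalPopulation x, ← Finset.sum_pair h]
  exact Finset.sum_le_univ_sum_of_nonneg (fun i => fractionalPopulation_nonneg x i)

theorem gammaNorm_nonneg (x : V → Fin k) : 0 ≤ gammaNorm x :=
  Finset.sum_nonneg fun _ _ => sq_nonneg _

theorem fractionalPopulation_sq_le_gammaNorm (x : V → Fin k) (i : Fin k) :
    fractionalPopulation x i ^ 2 ≤ gammaNorm x :=
  Finset.single_le_sum (f := fun i => fractionalPopulation x i ^ 2) (fun _ _ => sq_nonneg _)
    (Finset.mem_univ i)

theorem gammaNorm_le_one [Nonempty V] (x : V → Fin k) : gammaNorm x ≤ 1 := by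
  rw [← sum_fractionalPopulation x]
  refine Finset.sum_le_sum fun i _ => ?_
  nlinarith [fractionalPopulation_nonneg x i, fractionalPopulation_le_one x i]

theorem one_le_mul_gammaNorm [Nonempty V] (x : V → Fin k) : 1 ≤ k * gammaNorm x := by
  have h := sq_sum_le_card_mul_sum_sq (s := Finset.univ) (f := fractionalPopulation x)
  rw [sum_fractionalPopulation] at h
  simpa [gammaNorm] using h

theorem inv_card_le_fractionalPopulation (x : V → Fin k) (v : V) :
    1 / (Fintype.card V : ℝ) ≤ fractionalPopulation x (x v) := by
  unfold fractionalPopulation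
  gcongr
  have : 0 < (Finset.univ.filter fun w : V => x w = x v).card := Finset.card_pos.2 ⟨v, by simp⟩
  exact_mod_cast this

theorem exists_ne_of_not_isConsensus [Nonempty V] {x : V → Fin k} (h : ¬ IsConsensus x) :
    ∃ i j, i ≠ j ∧ 1 / (Fintype.card V : ℝ) ≤ fractionalPopulation x i ∧
      1 / (Fintype.card V : ℝ) ≤ fractionalPopulation x j := by
  obtain ⟨v⟩ := ‹Nonempty V›
  unfold IsConsensus at h
  push Not at h
  obtain ⟨w, hw⟩ := h (x v)
  exact ⟨x w, x v, hw, inv_card_le_fractionalPopulation x w, inv_card_le_fractionalPopulation x v⟩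

end Population

/-- Cauchy–Schwarz; applied twice, it gives the Hölder inequality for `geomMean`. -/
theorem prodExp_sqrt_mul_le {V ι : Type*} [Fintype V] [DecidableEq V] [Fintype ι] {q : V → ι → ℝ}
    (hq : IsLaw q) {f g : (V → ι) → ℝ} (hf : ∀ y, 0 ≤ f y) (hg : ∀ y, 0 ≤ g y) :
    prodExp q (fun y => √(f y * g y)) ≤ √(prodExp q f * prodExp q g) := by
  have h := Real.sum_sqrt_mul_sqrt_le Finset.univ
    (f := fun y : V → ι => (∏ v, q v (y v)) * f y) (g := fun y => (∏ v, q v (y v)) * g y)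
    (fun y => mul_nonneg (hq.prod_nonneg y) (hf y)) (fun y => mul_nonneg (hq.prod_nonneg y) (hg y))
  rw [Real.sqrt_mul (prodExp_nonneg hq hf)]
  refine le_of_eq_of_le (Finset.sum_congr rfl fun y _ => ?_) h
  have h0 := hq.prod_nonneg y
  rw [← Real.sqrt_mul (mul_nonneg h0 (hf y)),
    show (∏ v, q v (y v)) * f y * ((∏ v, q v (y v)) * g y) = (∏ v, q v (y v)) ^ 2 * (f y * g y) by ring,
    Real.sqrt_mul (sq_nonneg _), Real.sqrt_sq h0]

/-! ### One-round means, variances and inverse-square potentials -/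

section OpinionLaw

variable {V : Type*} [Fintype V] [DecidableEq V] {k : ℕ}

/-- The properties shared by the one-round laws of 3-Majority and 2-Choices: given the
configuration `x`, the next opinions are independent, `q x v` being the law of that of `v`. -/
structure IsOpinionLaw (q : (V → Fin k) → V → Fin k → ℝ) : Prop where
  law : ∀ x, IsLaw (q x)
  mean : ∀ x i, ∑ v, q x v i =
    Fintype.card V * (fractionalPopulation x i * (1 + fractionalPopulation x i - gammaNorm x))
  exp_gammaNorm : ∀ x, prodExp (q x) (fun y => Real.exp (-(Fintype.card V / 4 * gammaNorm y))) ≤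
    Real.exp (-(Fintype.card V / 4 * gammaNorm x))

/-- The variance of the next fractional population of the opinion `i`. -/
def populationVariance (q : (V → Fin k) → V → Fin k → ℝ) (x : V → Fin k) (i : Fin k) : ℝ :=
  (∑ v, q x v i * (1 - q x v i)) / (Fintype.card V : ℝ) ^ 2

variable {q : (V → Fin k) → V → Fin k → ℝ}

theorem populationVariance_nonneg (hq : IsOpinionLaw q) (x : V → Fin k) (i : Fin k) :
    0 ≤ populationVariance q x i :=
  div_nonneg (Finset.sum_nonneg fun v _ => mul_nonneg ((hq.law x).nonneg v i)
    (sub_nonneg.2 ((hq.law x).le_one v i))) (sq_nonneg _)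

theorem prodExp_fractionalPopulation [Nonempty V] (hq : IsOpinionLaw q) (x : V → Fin k) (i : Fin k) :
    prodExp (q x) (fun y => fractionalPopulation y i) =
      fractionalPopulation x i * (1 + fractionalPopulation x i - gammaNorm x) := by
  have hn : (Fintype.card V : ℝ) ≠ 0 := by exact_mod_cast Fintype.card_ne_zero
  simp only [fractionalPopulation_eq_sum (i := i)]
  rw [prodExp_sum]
  have : ∀ v, prodExp (q x) (fun y => (if y v = i then 1 else 0) / (Fintype.card V : ℝ)) =
      q x v i / Fintype.card V := fun v => by
    rw [prodExp_coord (hq.law x) v (fun c => (if c = i then 1 else 0) / (Fintype.card V : ℝ))]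
    simp [mul_div_assoc', ← Finset.sum_div]
  simp only [this]
  rw [← Finset.sum_div, hq.mean]
  simp only [fractionalPopulation_eq_sum]
  field_simp

theorem prodExp_inv_add_population_sq_le [Nonempty V] (hq : IsOpinionLaw q) (x : V → Fin k)
    (i : Fin k) {ε m : ℝ} (hε : 0 < ε)
    (hm : m = fractionalPopulation x i * (1 + fractionalPopulation x i - gammaNorm x)) :
    prodExp (q x) (fun y => 1 / (ε + fractionalPopulation y i ^ 2)) ≤
      1 / (ε + m ^ 2) * (1 - populationVariance q x i / (ε + m ^ 2) *
        (1 - 32 * (m ^ 2 / (ε + m ^ 2))) +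
        34 * (populationVariance q x i * (3 * populationVariance q x i +
          (1 / (Fintype.card V : ℝ)) ^ 2)) / (ε * (ε + m ^ 2))) := by
  have hn : (0 : ℝ) < Fintype.card V := by exact_mod_cast Fintype.card_pos
  have hmean : ∀ v, ∑ c, q x v c * ((if c = i then 1 else 0) / (Fintype.card V : ℝ)) =
      q x v i / Fintype.card V := fun v => by simp [mul_div_assoc', ← Finset.sum_div]
  have h := prodExp_inv_add_sq_le (hq.law x)
    (fun _ c => (if c = i then 1 else 0) / (Fintype.card V : ℝ)) (ε := ε)
    (b := 1 / (Fintype.card V : ℝ)) (m := m) (σ := populationVariance q x i) hε ?_ ?_ ?_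
  · simpa only [← fractionalPopulation_eq_sum] using h
  · intro v c
    rw [hmean, ← sub_div, abs_div, abs_of_pos hn]
    gcongr
    have h0 := (hq.law x).nonneg v i
    have h1 := (hq.law x).le_one v i
    rw [abs_le]
    split_ifs <;> constructor <;> linarith
  · simp only [hmean]
    rw [← Finset.sum_div, hq.mean, hm]
    field_simp
  · simp only [hmean, populationVariance]
    rw [Finset.sum_div]
    refine Finset.sum_congr rfl fun v _ => ?_
    have : ∑ c, q x v c * ((if c = i then 1 else 0) / (Fintype.card V : ℝ)) ^ 2 =
        q x v i / (Fintype.card V : ℝ) ^ 2 := by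
      simp [div_pow, mul_div_assoc', ← Finset.sum_div]
    rw [this]
    field_simp

/-- Here `σ` is the variance of the next difference. At each vertex the indicators of `i` and `j`
exclude each other, so their covariance is nonpositive and `σ` is at least each of the two
variances. -/
theorem prodExp_inv_add_difference_sq_le [Nonempty V] (hq : IsOpinionLaw q) (x : V → Fin k)
    {i j : Fin k} (hij : i ≠ j) {ε m : ℝ} (hε : 0 < ε)
    (hm : m = (fractionalPopulation x i - fractionalPopulation x j) *
      (1 + fractionalPopulation x i + fractionalPopulation x j - gammaNorm x)) :
    ∃ σ, populationVariance q x i ≤ σ ∧ populationVariance q x j ≤ σ ∧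
      σ ≤ 2 * (populationVariance q x i + populationVariance q x j) ∧
    prodExp (q x) (fun y => 1 / (ε + (fractionalPopulation y i - fractionalPopulation y j) ^ 2)) ≤
      1 / (ε + m ^ 2) * (1 - σ / (ε + m ^ 2) * (1 - 32 * (m ^ 2 / (ε + m ^ 2))) +
        34 * (σ * (3 * σ + (2 / (Fintype.card V : ℝ)) ^ 2)) / (ε * (ε + m ^ 2))) := by
  have hn : (0 : ℝ) < Fintype.card V := by exact_mod_cast Fintype.card_pos
  have hij1 : ∀ v, q x v i + q x v j ≤ 1 := fun v => by
    rw [← (hq.law x).sum_eq_one v, ← Finset.sum_pair hij]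
    exact Finset.sum_le_univ_sum_of_nonneg fun c => (hq.law x).nonneg v c
  have h0 := (hq.law x).nonneg
  set f : Fin k → ℝ := fun c => ((if c = i then 1 else 0) - (if c = j then 1 else 0)) /
    (Fintype.card V : ℝ) with hf
  have hmean : ∀ v, ∑ c, q x v c * f c = (q x v i - q x v j) / Fintype.card V := fun v => by
    simp [hf, mul_div_assoc', mul_sub, ← Finset.sum_div]
  have hsq : ∀ v, ∑ c, q x v c * f c ^ 2 = (q x v i + q x v j) / (Fintype.card V : ℝ) ^ 2 := by
    intro v
    have : ∀ c, q x v c * f c ^ 2 = ((if c = i then q x v c else 0) + (if c = j then q x v c else 0)) /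
        (Fintype.card V : ℝ) ^ 2 := by
      intro c
      simp only [hf, div_pow]
      by_cases h1 : c = i
      · have h2 : c ≠ j := fun h => hij (h1.symm.trans h)
        simp [h1, hij, div_eq_mul_inv]
      · by_cases h2 : c = j
        · simp [h2, hij.symm, div_eq_mul_inv]
        · simp [h1, h2]
    simp only [this, ← Finset.sum_div, Finset.sum_add_distrib]
    simp
  set σ := ∑ v, ((∑ c, q x v c * f c ^ 2) - (∑ c, q x v c * f c) ^ 2) with hσ
  have hσ' : σ = (∑ v, (q x v i * (1 - q x v i) + q x v j * (1 - q x v j) + 2 * q x v i * q x v j)) /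
      (Fintype.card V : ℝ) ^ 2 := by
    rw [hσ, Finset.sum_div]
    refine Finset.sum_congr rfl fun v _ => ?_
    rw [hsq, hmean]
    field_simp
    ring
  have hnn : ∀ v c, 0 ≤ q x v c * (1 - q x v c) := fun v c =>
    mul_nonneg (h0 v c) (sub_nonneg.2 ((hq.law x).le_one v c))
  refine ⟨σ, ?_, ?_, ?_, ?_⟩
  · rw [hσ', populationVariance]
    gcongr with v
    have := mul_nonneg (h0 v i) (h0 v j)
    linarith [hnn v j]
  · rw [hσ', populationVariance]
    gcongr with v
    have := mul_nonneg (h0 v i) (h0 v j)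
    linarith [hnn v i]
  · rw [hσ', populationVariance, populationVariance, ← add_div, ← Finset.sum_add_distrib,
      ← mul_div_assoc, Finset.mul_sum]
    gcongr with v
    nlinarith [h0 v i, h0 v j, hij1 v]
  · have h := prodExp_inv_add_sq_le (hq.law x) (fun _ c => f c) (ε := ε)
      (b := 2 / (Fintype.card V : ℝ)) (m := m) (σ := σ) hε ?_ ?_ hσ
    · have e : ∀ y : V → Fin k, fractionalPopulation y i - fractionalPopulation y j =
          ∑ v, f (y v) := fun y => by
        rw [fractionalPopulation_eq_sum, fractionalPopulation_eq_sum, ← Finset.sum_sub_distrib]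
        exact Finset.sum_congr rfl fun v _ => by simp only [hf, sub_div]
      simpa only [e] using h
    · intro v c
      rw [hmean, hf, ← sub_div, abs_div, abs_of_pos hn]
      gcongr
      have h1 := h0 v i
      have h2 := h0 v j
      have h3 := hij1 v
      rw [abs_le]
      split_ifs <;> constructor <;> linarith
    · simp only [hmean]
      rw [← Finset.sum_div, Finset.sum_sub_distrib, hq.mean, hq.mean, hm]
      field_simp
      ring

end OpinionLaw

/-! ### Numerical contraction estimates -/

/-- The case of a rare opinion, where the mean factor `c` of the difference `δ` may be below `1`. As
`ρ ≤ 1` and `ρ ≤ c`, the drift costs at most `ρ⁻²`, and the noise at most `1 + g/10`. -/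
theorem inv_sq_contraction_of_small {ε δ ρ c σ b g : ℝ} (hε : 0 < ε) (hρ : 0 < ρ) (hρ1 : ρ ≤ 1)
    (hc : ρ ≤ c) (hσ : 0 ≤ σ) (hσg : 640 * σ ≤ g * ε) (hb : 68 * (3 * σ + b ^ 2) ≤ ε) :
    1 / (ε + (δ * c) ^ 2) * (1 - σ / (ε + (δ * c) ^ 2) *
      (1 - 32 * ((δ * c) ^ 2 / (ε + (δ * c) ^ 2))) +
      34 * (σ * (3 * σ + b ^ 2)) / (ε * (ε + (δ * c) ^ 2))) ≤
    (1 + g / 10) / ρ ^ 2 * (1 / (ε + δ ^ 2)) := by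
  set A := ε + (δ * c) ^ 2 with hA
  have hA0 : 0 < A := by positivity
  have hεA : ε ≤ A := by rw [hA]; nlinarith [sq_nonneg (δ * c)]
  have hq1 : (δ * c) ^ 2 / A ≤ 1 := by rw [div_le_one hA0, hA]; linarith
  have hq0 : 0 ≤ (δ * c) ^ 2 / A := by positivity
  have h1 : 34 * (σ * (3 * σ + b ^ 2)) / (ε * A) ≤ σ / A * (1 / 2) := by
    rw [div_mul_div_comm, div_le_div_iff₀ (by positivity) (by positivity)]
    nlinarith [mul_le_mul_of_nonneg_left hb (mul_nonneg hσ hA0.le)]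
  have h2 : σ / A ≤ g / 640 := by
    have : σ / A ≤ σ / ε := by gcongr
    refine this.trans ?_
    rw [div_le_div_iff₀ hε (by norm_num)]
    linarith
  have h3 : 0 ≤ σ / A := by positivity
  have h4 : 1 - σ / A * (1 - 32 * ((δ * c) ^ 2 / A)) + 34 * (σ * (3 * σ + b ^ 2)) / (ε * A) ≤
      1 + g / 10 := by nlinarith
  have h5 : 1 / A ≤ 1 / ρ ^ 2 * (1 / (ε + δ ^ 2)) := by
    rw [div_mul_div_comm, one_mul]
    refine one_div_le_one_div_of_le (by positivity) ?_
    have hρc : ρ ^ 2 ≤ c ^ 2 := by gcongr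
    have hρ2 : ρ ^ 2 ≤ 1 := pow_le_one₀ hρ.le hρ1
    rw [hA]
    nlinarith [mul_le_mul_of_nonneg_left hρc (sq_nonneg δ)]
  have hg : 0 ≤ g := by nlinarith
  calc _ ≤ 1 / A * (1 + g / 10) := by gcongr
    _ ≤ 1 / ρ ^ 2 * (1 / (ε + δ ^ 2)) * (1 + g / 10) := by gcongr
    _ = _ := by ring

/-- The case of two popular opinions. With `r = m ^ 2 / (ε + m ^ 2)` for the mean `m = δ * (1 + d)`,
the noise helps when `r` is small, because `1 / (ε + x ^ 2)` is concave near `0`; the drift helps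
when `r` is large. -/
theorem inv_sq_contraction_of_drift {ε δ d σ b g : ℝ} (hε : 0 < ε) (hg : 0 < g) (hg1 : g ≤ 1)
    (hd : g / 5 ≤ d) (hσ0 : g * ε / 100000 ≤ σ) (hσg : 640 * σ ≤ g * ε)
    (hb : 68 * (3 * σ + b ^ 2) ≤ ε) :
    1 / (ε + (δ * (1 + d)) ^ 2) * (1 - σ / (ε + (δ * (1 + d)) ^ 2) *
      (1 - 32 * ((δ * (1 + d)) ^ 2 / (ε + (δ * (1 + d)) ^ 2))) +
      34 * (σ * (3 * σ + b ^ 2)) / (ε * (ε + (δ * (1 + d)) ^ 2))) ≤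
    (1 - g / 500000) * (1 / (ε + δ ^ 2)) := by
  set A := ε + (δ * (1 + d)) ^ 2 with hA
  have hA0 : 0 < A := by positivity
  have hd0 : 0 < d := by linarith
  have hεA : ε ≤ A := by rw [hA]; nlinarith [sq_nonneg (δ * (1 + d))]
  set r := (δ * (1 + d)) ^ 2 / A with hr
  have hr1 : r ≤ 1 := by rw [hr, div_le_one hA0, hA]; linarith
  have hr0 : 0 ≤ r := by positivity
  have hrA : r * A = (δ * (1 + d)) ^ 2 := by rw [hr]; field_simp
  have hεr : ε = (1 - r) * A := by rw [sub_mul, hrA, hA]; ring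
  have hσp : 0 ≤ σ := le_trans (by positivity) hσ0
  have h1 : 34 * (σ * (3 * σ + b ^ 2)) / (ε * A) ≤ σ / A * (1 / 2) := by
    rw [div_mul_div_comm, div_le_div_iff₀ (by positivity) (by positivity)]
    nlinarith [mul_le_mul_of_nonneg_left hb (mul_nonneg hσp hA0.le)]
  have h2 : σ / A ≤ g / 640 := by
    have : σ / A ≤ σ / ε := by gcongr
    refine this.trans ?_
    rw [div_le_div_iff₀ hε (by norm_num)]
    linarith
  have h3 : 0 ≤ σ / A := by positivity
  have hA1 : ε + δ ^ 2 ≤ (1 - g * r / 10) * A := by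
    have e1 : δ ^ 2 * (1 + d) ^ 2 = r * A := by rw [hrA]; ring
    have h4 : 1 + 2 * g / 5 ≤ (1 + d) ^ 2 := by nlinarith [sq_nonneg d]
    have h5 : (1 + 2 * g / 5) * (1 - g / 10) ≤ (1 + d) ^ 2 * (1 - g / 10) :=
      mul_le_mul_of_nonneg_right h4 (by linarith)
    have h6 : δ ^ 2 ≤ (r * A) * (1 - g / 10) := by
      rw [← e1]
      have h7 : 1 ≤ (1 + d) ^ 2 * (1 - g / 10) := by nlinarith
      nlinarith [mul_le_mul_of_nonneg_left h7 (sq_nonneg δ)]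
    nlinarith
  have hA2 : 1 / A ≤ (1 - g * r / 10) * (1 / (ε + δ ^ 2)) := by
    rw [mul_one_div, div_le_div_iff₀ hA0 (by positivity)]
    linarith
  have hA2' : 1 / A ≤ 1 / (ε + δ ^ 2) := by
    refine one_div_le_one_div_of_le (by positivity) (hA1.trans ?_)
    nlinarith [mul_nonneg hg.le hr0]
  -- For `r ≤ 1/128` the second-order gain is at least `3/4 * (σ/A)` and the fourth-order loss at
  -- most half of `σ/A`. For `r ≥ 1/128` the drift gains `g * r / 10` and the noise loses at most `g
  -- * r / 20`.
  rcases le_total r (1 / 128) with h | h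
  · have h4 : 1 - σ / A * (1 - 32 * r) + 34 * (σ * (3 * σ + b ^ 2)) / (ε * A) ≤
        1 - g / 500000 := by
      have h5 : g / 110000 ≤ σ / A := by
        rw [le_div_iff₀ hA0]
        rw [hεr] at hσ0
        nlinarith [mul_nonneg hg.le hA0.le]
      nlinarith [mul_le_mul_of_nonneg_left h h3]
    calc _ ≤ 1 / A * (1 - g / 500000) := by gcongr
      _ ≤ 1 / (ε + δ ^ 2) * (1 - g / 500000) := by
        gcongr; linarith
      _ = _ := by ring
  · have h4 : 1 - σ / A * (1 - 32 * r) + 34 * (σ * (3 * σ + b ^ 2)) / (ε * A) ≤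
        1 + g * r / 20 := by nlinarith
    calc _ ≤ 1 / A * (1 + g * r / 20) := by gcongr
      _ ≤ (1 - g * r / 10) * (1 / (ε + δ ^ 2)) * (1 + g * r / 20) := by gcongr
      _ = (1 - g * r / 10) * (1 + g * r / 20) * (1 / (ε + δ ^ 2)) := by ring
      _ ≤ _ := by
        gcongr
        nlinarith [mul_nonneg hg.le hr0]

/-- For one dominant opinion the drift alone wins: it gains `g / 10`, and the noise loses at most `g
/ 20`. -/
theorem inv_sq_contraction_of_large {g α d σ b : ℝ} (hg : 0 < g) (hg1 : g ≤ 1)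
    (hα : 3 / 2 * g ≤ α) (hd : 3 / 10 * g ≤ d) (hσ : 0 ≤ σ)
    (hσα : 2560 * σ ≤ g * α ^ 2) (hσg : σ ≤ g ^ 2 / 5) (hb : b ^ 2 ≤ g ^ 2 / 5) :
    1 / (g ^ 2 + (α * (1 + d)) ^ 2) * (1 - σ / (g ^ 2 + (α * (1 + d)) ^ 2) *
      (1 - 32 * ((α * (1 + d)) ^ 2 / (g ^ 2 + (α * (1 + d)) ^ 2))) +
      34 * (σ * (3 * σ + b ^ 2)) / (g ^ 2 * (g ^ 2 + (α * (1 + d)) ^ 2))) ≤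
    (1 - g / 20) * (1 / (g ^ 2 + α ^ 2)) := by
  set A := g ^ 2 + (α * (1 + d)) ^ 2 with hA
  have hA0 : 0 < A := by positivity
  have hα0 : 0 < α := by linarith
  have hd0 : 0 < d := by linarith
  set r := (α * (1 + d)) ^ 2 / A with hr
  have hr1 : r ≤ 1 := by rw [hr, div_le_one hA0, hA]; nlinarith
  have hr0 : 0 ≤ r := by positivity
  have hαA : α ^ 2 ≤ A := by
    have h1 : 1 ≤ (1 + d) ^ 2 := one_le_pow₀ (by linarith)
    rw [hA, mul_pow]
    nlinarith [mul_le_mul_of_nonneg_left h1 (sq_nonneg α), sq_nonneg g]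
  have h3 : 0 ≤ σ / A := by positivity
  have h2 : σ / A ≤ g / 2560 := by
    rw [div_le_div_iff₀ hA0 (by norm_num)]
    nlinarith
  have h1 : 34 * (σ * (3 * σ + b ^ 2)) / (g ^ 2 * A) ≤ σ / A * 34 := by
    rw [div_mul_eq_mul_div, div_le_div_iff₀ (by positivity) (by positivity)]
    have : σ * (3 * σ + b ^ 2) ≤ σ * g ^ 2 := by gcongr; linarith
    nlinarith
  have h4 : 1 - σ / A * (1 - 32 * r) + 34 * (σ * (3 * σ + b ^ 2)) / (g ^ 2 * A) ≤
      1 + g / 20 := by nlinarith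
  have hA1 : g ^ 2 + α ^ 2 ≤ (1 - g / 10) * A := by
    have h5 : g ^ 2 ≤ 4 / 9 * α ^ 2 := by nlinarith
    have h6 : A = g ^ 2 + α ^ 2 * (1 + 2 * d + d ^ 2) := by rw [hA]; ring
    have h7 : (2 * d + d ^ 2) * (9 / 10) ≥ g / 10 * (13 / 9) := by nlinarith [sq_nonneg d]
    have h8 := mul_le_mul_of_nonneg_left h7 (sq_nonneg α)
    have h9 : 0 ≤ (2 * d + d ^ 2) * α ^ 2 := by positivity
    rw [h6]
    nlinarith
  have hA2 : 1 / A ≤ (1 - g / 10) * (1 / (g ^ 2 + α ^ 2)) := by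
    rw [mul_one_div, div_le_div_iff₀ hA0 (by positivity)]
    linarith
  calc _ ≤ 1 / A * (1 + g / 20) := by gcongr
    _ ≤ (1 - g / 10) * (1 / (g ^ 2 + α ^ 2)) * (1 + g / 20) := by gcongr
    _ = (1 - g / 10) * (1 + g / 20) * (1 / (g ^ 2 + α ^ 2)) := by ring
    _ ≤ _ := by
      gcongr
      nlinarith

/-- The geometric mean of `U`, `U`, `U` and `H`. -/
def geomMean (U H : ℝ) : ℝ := √(U * √(U * H))

theorem geomMean_nonneg (U H : ℝ) : 0 ≤ geomMean U H := Real.sqrt_nonneg _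

theorem geomMean_pow_four {U H : ℝ} (hU : 0 ≤ U) (hH : 0 ≤ H) : geomMean U H ^ 4 = U ^ 3 * H := by
  rw [geomMean, show 4 = 2 * 2 from rfl, pow_mul, Real.sq_sqrt (by positivity), mul_pow,
    Real.sq_sqrt (by positivity)]
  ring

/-- Hölder's inequality with exponents `3/4` and `1/4`. A gain `z` in `U ^ 3 * H` becomes a gain `z
/ 4` after the fourth root, by Bernoulli. -/
theorem prodExp_geomMean_le {V ι : Type*} [Fintype V] [DecidableEq V] [Fintype ι] {q : V → ι → ℝ}
    (hq : IsLaw q) {f g : (V → ι) → ℝ} (hf : ∀ y, 0 ≤ f y) (hg : ∀ y, 0 ≤ g y) {a b U H z : ℝ}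
    (hU : 0 ≤ U) (hH : 0 ≤ H) (hz : z ≤ 1)
    (ha : prodExp q f ≤ a) (hb : prodExp q g ≤ b) (h : a ^ 3 * b ≤ (1 - z) * (U ^ 3 * H)) :
    prodExp q (fun y => geomMean (f y) (g y)) ≤ (1 - z / 4) * geomMean U H := by
  have ha0 := (prodExp_nonneg hq hf).trans ha
  have hb0 := (prodExp_nonneg hq hg).trans hb
  have h1 : prodExp q (fun y => geomMean (f y) (g y)) ≤ geomMean a b := by
    refine (prodExp_sqrt_mul_le hq hf fun y => Real.sqrt_nonneg _).trans ?_
    refine Real.sqrt_le_sqrt (mul_le_mul ha ?_ (prodExp_nonneg hq fun y => Real.sqrt_nonneg _) ha0)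
    exact (prodExp_sqrt_mul_le hq hf hg).trans
      (Real.sqrt_le_sqrt (mul_le_mul ha hb (prodExp_nonneg hq hg) ha0))
  refine h1.trans ?_
  refine le_of_pow_le_pow_left₀ (n := 4) (by norm_num)
    (mul_nonneg (by linarith) (geomMean_nonneg _ _)) ?_
  rw [mul_pow, geomMean_pow_four ha0 hb0, geomMean_pow_four hU hH]
  refine h.trans (mul_le_mul_of_nonneg_right ?_ (by positivity))
  have h2 := one_add_mul_le_pow (a := -(z / 4)) (by linarith) 4
  push_cast at h2
  rw [sub_eq_add_neg]
  linarith

/-! ### One stage: consensus or growth of the squared norm -/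

section Stage

variable {V : Type*} [Fintype V] [DecidableEq V] {k : ℕ}

/-- The potential of a pair of opinions; it is small if one of them is rare or if they are far
apart. -/
def pairPotential (g ε : ℝ) (i j : Fin k) (x : V → Fin k) : ℝ :=
  geomMean (min (min (fractionalPopulation x i) (fractionalPopulation x j)) (7 / 10 * g))
    (1 / (ε + (fractionalPopulation x i - fractionalPopulation x j) ^ 2))

variable {q : (V → Fin k) → V → Fin k → ℝ}

theorem prodExp_pairPotential_le [Nonempty V] (hq : IsOpinionLaw q) {g ε : ℝ} (hg : 0 < g)
    (hg1 : g ≤ 1) (hε : 0 < ε) (hεn : 816 ≤ ε * (Fintype.card V : ℝ) ^ 2) {x : V → Fin k}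
    (hx : 9 / 10 * g ≤ gammaNorm x) (hx' : gammaNorm x < 6 / 5 * g) {i j : Fin k} (hij : i ≠ j)
    (hi : 2560 * populationVariance q x i ≤ g * ε) (hj : 2560 * populationVariance q x j ≤ g * ε)
    (hlow : 7 / 10 * g ≤ fractionalPopulation x i → 7 / 10 * g ≤ fractionalPopulation x j →
      g * ε / 100000 ≤ populationVariance q x i ∨ g * ε / 100000 ≤ populationVariance q x j) :
    prodExp (q x) (pairPotential g ε i j) ≤ (1 - g / 500000 / 4) * pairPotential g ε i j x := by
  have hn : (0 : ℝ) < Fintype.card V := by exact_mod_cast Fintype.card_pos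
  obtain ⟨σ, hσi, hσj, hσ, hH⟩ := prodExp_inv_add_difference_sq_le hq x hij hε rfl
  have hσ0 : 0 ≤ σ := (populationVariance_nonneg hq x i).trans hσi
  have hσg : 640 * σ ≤ g * ε := by linarith
  have hb : 68 * (3 * σ + (2 / (Fintype.card V : ℝ)) ^ 2) ≤ ε := by
    have h1 : (2 / (Fintype.card V : ℝ)) ^ 2 ≤ ε / 204 := by
      rw [div_pow, div_le_div_iff₀ (by positivity) (by norm_num)]; linarith
    nlinarith
  have hU0 : ∀ y : V → Fin k, 0 ≤ min (min (fractionalPopulation y i) (fractionalPopulation y j))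
      (7 / 10 * g) := fun y => le_min (le_min (fractionalPopulation_nonneg y i)
        (fractionalPopulation_nonneg y j)) (by positivity)
  have hH0 : ∀ y : V → Fin k, 0 ≤
      1 / (ε + (fractionalPopulation y i - fractionalPopulation y j) ^ 2) := fun y => by positivity
  set a := fractionalPopulation x i with ha
  set b := fractionalPopulation x j with hb'
  have hγ1 := gammaNorm_le_one x
  rcases lt_or_ge (min a b) (7 / 10 * g) with hcase | hcase
  -- A rare opinion: the rarer one has mean factor `ρ = 1 + min a b - γ ≤ 1 - g/5`, since `7/10 -
  -- 9/10 = -1/5`. `H` may grow by `ρ⁻² * (1 + g/10)`; the weights `3 : 1` in the geometric mean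
  -- leave one factor `ρ` to spare.
  · have hμ0 : 0 ≤ min a b := le_min (fractionalPopulation_nonneg x i) (fractionalPopulation_nonneg x j)
    have hEU : prodExp (q x) (fun y => min (min (fractionalPopulation y i)
        (fractionalPopulation y j)) (7 / 10 * g)) ≤ min a b * (1 + min a b - gammaNorm x) := by
      rcases min_choice a b with h | h
      · rw [h, ha, ← prodExp_fractionalPopulation hq]
        exact prodExp_mono (hq.law x) fun y => (min_le_left _ _).trans (min_le_left _ _)
      · rw [h, hb', ← prodExp_fractionalPopulation hq]
        exact prodExp_mono (hq.law x) fun y => (min_le_left _ _).trans (min_le_right _ _)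
    rcases hμ0.eq_or_lt with hμ | hμ
    · refine prodExp_geomMean_le (hq.law x) hU0 hH0 (hU0 x) (hH0 x) (by linarith) hEU le_rfl ?_
      rw [← hμ, zero_mul, zero_pow (by norm_num), zero_mul]
      have := hU0 x
      have := hH0 x
      have : 0 ≤ 1 - g / 500000 := by linarith
      positivity
    · have hρ : 0 < 1 + min a b - gammaNorm x := by linarith
      have hc : 1 + min a b - gammaNorm x ≤ 1 + a + b - gammaNorm x := by
        have h1 := fractionalPopulation_nonneg x i
        have h2 := fractionalPopulation_nonneg x j
        rcases min_choice a b with h | h <;> rw [h] <;> linarith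
      have h1 := hH.trans (inv_sq_contraction_of_small (δ := a - b) hε hρ (by linarith) hc hσ0 hσg hb)
      refine prodExp_geomMean_le (hq.law x) hU0 hH0 (hU0 x) (hH0 x) (by linarith) hEU h1 ?_
      rw [← ha, ← hb', min_eq_left hcase.le]
      set ρ := 1 + min a b - gammaNorm x with hρ'
      have h2 : (min a b * ρ) ^ 3 * ((1 + g / 10) / ρ ^ 2 * (1 / (ε + (a - b) ^ 2))) =
          (ρ * (1 + g / 10)) * (min a b ^ 3 * (1 / (ε + (a - b) ^ 2))) := by
        field_simp
      rw [h2]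
      refine mul_le_mul_of_nonneg_right ?_ (by positivity)
      have h3 : ρ ≤ 1 - g / 5 := by linarith
      have h4 := mul_le_mul_of_nonneg_right h3 (by linarith : 0 ≤ 1 + g / 10)
      nlinarith
  -- Both opinions are popular: the truncation prevents `U` from growing, and the difference has
  -- drift at least `2 * 7/10 * g - 6/5 * g = g/5`.
  · have hia : 7 / 10 * g ≤ a := hcase.trans (min_le_left _ _)
    have hjb : 7 / 10 * g ≤ b := hcase.trans (min_le_right _ _)
    have hd : g / 5 ≤ a + b - gammaNorm x := by linarith
    have hσl : g * ε / 100000 ≤ σ := (hlow hia hjb).elim (fun h => h.trans hσi) fun h => h.trans hσj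
    have e : 1 + a + b - gammaNorm x = 1 + (a + b - gammaNorm x) := by ring
    rw [e] at hH
    have h1 := hH.trans (inv_sq_contraction_of_drift (δ := a - b) hε hg hg1 hd hσl hσg hb)
    have hEU : prodExp (q x) (fun y => min (min (fractionalPopulation y i)
        (fractionalPopulation y j)) (7 / 10 * g)) ≤ 7 / 10 * g := by
      refine (prodExp_mono (hq.law x) fun y => min_le_right _ _).trans (prodExp_const (hq.law x) _).le
    refine prodExp_geomMean_le (hq.law x) hU0 hH0 (hU0 x) (hH0 x) (by linarith) hEU h1 ?_
    rw [← ha, ← hb', min_eq_right hcase]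
    exact le_of_eq (by ring)

theorem prodExp_inv_le_of_large [Nonempty V] (hq : IsOpinionLaw q) {g : ℝ} (hg : 0 < g)
    (hg1 : g ≤ 1) (hgn : 5 ≤ g ^ 2 * (Fintype.card V : ℝ) ^ 2) {x : V → Fin k}
    (hx' : gammaNorm x < 6 / 5 * g) {i : Fin k} (hi : 3 / 2 * g ≤ fractionalPopulation x i)
    (hv : 2560 * populationVariance q x i ≤ g * fractionalPopulation x i ^ 2)
    (hv' : populationVariance q x i ≤ g ^ 2 / 5) :
    prodExp (q x) (fun y => 1 / (g ^ 2 + fractionalPopulation y i ^ 2)) ≤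
      (1 - g / 20) * (1 / (g ^ 2 + fractionalPopulation x i ^ 2)) := by
  have hn : (0 : ℝ) < Fintype.card V := by exact_mod_cast Fintype.card_pos
  have hH := prodExp_inv_add_population_sq_le hq x i (pow_pos hg 2) rfl
  rw [add_sub_assoc] at hH
  refine hH.trans (inv_sq_contraction_of_large hg hg1 hi (by linarith)
    (populationVariance_nonneg hq x i) hv hv' ?_)
  rw [div_pow, one_pow, div_le_div_iff₀ (by positivity) (by norm_num)]
  linarith

/-- The transition matrix of the chain with one-round laws `q`. -/
def lawMatrix (q : (V → Fin k) → V → Fin k → ℝ) (x y : V → Fin k) : ℝ := ∏ v, q x v (y v)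

theorem isStochastic_lawMatrix (hq : IsOpinionLaw q) : IsStochastic (lawMatrix q) where
  nonneg x y := (hq.law x).prod_nonneg y
  sum_eq_one x := (hq.law x).sum_prod_eq_one

theorem sum_lawMatrix_mul (x : V → Fin k) (f : (V → Fin k) → ℝ) :
    ∑ y, lawMatrix q x y * f y = prodExp (q x) f := rfl

/-- The bounds on the fluctuations in one round that hold while `gammaNorm` is near `g`. -/
structure FluctuationBounds (q : (V → Fin k) → V → Fin k → ℝ) (g ε l : ℝ) : Prop where
  pos : 0 < g
  le_one : g ≤ 1
  card : 5 ≤ g ^ 2 * (Fintype.card V : ℝ) ^ 2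
  eps_le_one : ε ≤ 1
  eps_card : 816 ≤ ε * (Fintype.card V : ℝ) ^ 2
  upper : ∀ x i, 9 / 10 * g ≤ gammaNorm x → gammaNorm x < 6 / 5 * g →
    (∀ j, fractionalPopulation x j ≤ 2 * g) → 2560 * populationVariance q x i ≤ g * ε
  lower : ∀ x i j, i ≠ j → gammaNorm x < 6 / 5 * g → 7 / 10 * g ≤ fractionalPopulation x j →
    fractionalPopulation x j ≤ fractionalPopulation x i → g * ε / 100000 ≤ populationVariance q x j
  large : ∀ x i, gammaNorm x < 6 / 5 * g → 3 / 2 * g ≤ fractionalPopulation x i →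
    2560 * populationVariance q x i ≤ g * fractionalPopulation x i ^ 2 ∧
      populationVariance q x i ≤ g ^ 2 / 5
  exp_large : ∀ x i, gammaNorm x < 6 / 5 * g → 3 / 2 * g ≤ fractionalPopulation x i →
    prodExp (q x) (fun y => Real.exp (-(l * fractionalPopulation y i))) ≤
      Real.exp (-(l * fractionalPopulation x i))

theorem avoid_le_of_large [Nonempty V] (hq : IsOpinionLaw q) {g ε l : ℝ} (hl : 0 ≤ l)
    (h : FluctuationBounds q g ε l) {D : (V → Fin k) → Prop}
    (hD : ∀ x, ¬ D x → gammaNorm x < 6 / 5 * g) {x : V → Fin k} {i : Fin k}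
    (hi : 2 * g ≤ fractionalPopulation x i) (t : ℕ) :
    avoid (lawMatrix q) D t x ≤ Real.exp (-(l * g / 2)) + 2 / g ^ 2 * (1 - g / 20) ^ t := by
  have hK := isStochastic_lawMatrix hq
  have hg := h.pos
  have hg1 := h.le_one
  -- As long as opinion `i` stays above `3/2 * g`, its drift `α i - γ` exceeds `3/10 * g`. The
  -- exponential supermartingale controls a descent from `2 * g` to this level.
  set B : (V → Fin k) → Prop := fun x => fractionalPopulation x i < 3 / 2 * g with hB
  have h1 := avoid_le_avoid_or_add (D := D) (B := B) hK
    (h := fun y => Real.exp (-(l * fractionalPopulation y i)) * Real.exp (l * (3 / 2 * g)))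
    (fun y => by positivity) (fun y hy => by
      rw [← Real.exp_add]
      refine Real.one_le_exp ?_
      nlinarith [hy.le]) (fun y hy hy' => by
      rw [sum_lawMatrix_mul]
      simp_rw [mul_comm _ (Real.exp (l * (3 / 2 * g)))]
      rw [prodExp_const_mul]
      exact mul_le_mul_of_nonneg_left (h.exp_large y i (hD y hy) (not_lt.1 hy'))
        (Real.exp_pos _).le) t x
  have h2 : Real.exp (-(l * fractionalPopulation x i)) * Real.exp (l * (3 / 2 * g)) ≤
      Real.exp (-(l * g / 2)) := by
    rw [← Real.exp_add]
    exact Real.exp_le_exp.2 (by nlinarith)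
  have h3 := mul_avoid_le_of_contraction (D := fun x => D x ∨ B x) hK
    (Φ := fun y => 1 / (g ^ 2 + fractionalPopulation y i ^ 2)) (r := 1 - g / 20) (φ := 1 / 2)
    (by linarith) (fun y => by positivity) (fun y _ => by
      refine one_div_le_one_div_of_le (by positivity) ?_
      nlinarith [fractionalPopulation_le_one y i, fractionalPopulation_nonneg y i])
    (fun y hy => by
      rw [sum_lawMatrix_mul]
      have hy1 := hD y fun h => hy (Or.inl h)
      have hy2 : 3 / 2 * g ≤ fractionalPopulation y i := not_lt.1 fun h => hy (Or.inr h)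
      exact prodExp_inv_le_of_large hq hg hg1 h.card hy1 hy2 (h.large y i hy1 hy2).1
        (h.large y i hy1 hy2).2) t x
  have h4 : 1 / (g ^ 2 + fractionalPopulation x i ^ 2) ≤ 1 / g ^ 2 :=
    one_div_le_one_div_of_le (by positivity) (by nlinarith [sq_nonneg (fractionalPopulation x i)])
  have h5 : (1 - g / 20) ^ t * (1 / (g ^ 2 + fractionalPopulation x i ^ 2)) ≤
      (1 - g / 20) ^ t * (1 / g ^ 2) :=
    mul_le_mul_of_nonneg_left h4 (pow_nonneg (by linarith) t)
  have h6 : 2 / g ^ 2 * (1 - g / 20) ^ t = 2 * ((1 - g / 20) ^ t * (1 / g ^ 2)) := by ring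
  linarith

theorem avoid_le_of_pairs [Nonempty V] (hq : IsOpinionLaw q) {g ε l : ℝ} (hkn : k ≤ Fintype.card V)
    (h : FluctuationBounds q g ε l) {D : (V → Fin k) → Prop}
    (hD : ∀ x, ¬ D x → ¬ IsConsensus x ∧ 9 / 10 * g ≤ gammaNorm x ∧ gammaNorm x < 6 / 5 * g ∧
      ∀ j, fractionalPopulation x j ≤ 2 * g) (t : ℕ) (x : V → Fin k) :
    avoid (lawMatrix q) D t x ≤ (Fintype.card V : ℝ) ^ 4 * (1 - g / 2000000) ^ t := by
  have hK := isStochastic_lawMatrix hq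
  have hg := h.pos
  have hg1 := h.le_one
  have hn : (0 : ℝ) < Fintype.card V := by exact_mod_cast Fintype.card_pos
  set n : ℝ := (Fintype.card V : ℝ) with hn'
  have hε : 0 < ε := by
    have := h.eps_card
    by_contra hneg
    have : ε * n ^ 2 ≤ 0 := mul_nonpos_of_nonpos_of_nonneg (not_lt.1 hneg) (sq_nonneg _)
    linarith
  have hgn : 2 ≤ g * n := by nlinarith [h.card, mul_pos hg hn]
  have hn2 : 2 ≤ n := by nlinarith
  set Ψ : (V → Fin k) → ℝ := fun y => ∑ i, ∑ j, if i = j then 0 else pairPotential g ε i j y with hΨ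
  have hP0 : ∀ i j (y : V → Fin k), 0 ≤ pairPotential g ε i j y := fun i j y => geomMean_nonneg _ _
  have hI0 : ∀ i j (y : V → Fin k), 0 ≤ if i = j then 0 else pairPotential g ε i j y :=
    fun i j y => by split_ifs; exacts [le_rfl, hP0 i j y]
  have h1 := mul_avoid_le_of_contraction (D := D) hK (Φ := Ψ) (r := 1 - g / 500000 / 4) (φ := 1 / n)
    (by linarith) (fun y => Finset.sum_nonneg fun i _ => Finset.sum_nonneg fun j _ => hI0 i j y)
    (fun y hy => by
      -- Two surviving opinions have populations at least `1 / n`, so both `U` and `H` of this pair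
      -- are at least `1 / n`, and so is their geometric mean.
      obtain ⟨i, j, hij, hi, hj⟩ := exists_ne_of_not_isConsensus (hD y hy).1
      have h2 : pairPotential g ε i j y ≤ Ψ y := by
        refine le_trans ?_ (Finset.single_le_sum (f := fun i => ∑ j, if i = j then 0 else
          pairPotential g ε i j y) (fun i _ => Finset.sum_nonneg fun j _ => hI0 i j y)
          (Finset.mem_univ i))
        refine le_trans ?_ (Finset.single_le_sum (f := fun j => if i = j then 0 else
          pairPotential g ε i j y) (fun j _ => hI0 i j y) (Finset.mem_univ j))
        simp [hij]
      refine le_trans ?_ h2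
      have hU : 1 / n ≤ min (min (fractionalPopulation y i) (fractionalPopulation y j))
          (7 / 10 * g) := by
        refine le_min (le_min hi hj) ?_
        rw [div_le_iff₀ hn]
        linarith
      have hδ : (fractionalPopulation y i - fractionalPopulation y j) ^ 2 ≤ 1 := by
        rw [sq_le_one_iff_abs_le_one, abs_le]
        constructor <;> linarith [fractionalPopulation_le_one y i, fractionalPopulation_le_one y j,
          fractionalPopulation_nonneg y i, fractionalPopulation_nonneg y j]
      have hH : 1 / n ≤ 1 / (ε + (fractionalPopulation y i - fractionalPopulation y j) ^ 2) :=
        one_div_le_one_div_of_le (by positivity) (by linarith [h.eps_le_one])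
      have hn0 : 0 ≤ 1 / n := by positivity
      refine le_of_pow_le_pow_left₀ (n := 4) (by norm_num) (hP0 i j y) ?_
      rw [pairPotential, geomMean_pow_four (hn0.trans hU) (hn0.trans hH), pow_succ]
      exact mul_le_mul (pow_le_pow_left₀ hn0 hU 3) hH hn0 (pow_nonneg (hn0.trans hU) 3))
    (fun y hy => by
      obtain ⟨-, hy1, hy2, hy3⟩ := hD y hy
      rw [sum_lawMatrix_mul, hΨ, prodExp_sum, Finset.mul_sum]
      refine Finset.sum_le_sum fun i _ => ?_
      rw [prodExp_sum, Finset.mul_sum]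
      refine Finset.sum_le_sum fun j _ => ?_
      by_cases hij : i = j
      · simp [hij, prodExp_const (hq.law y)]
      · simp only [hij, if_false]
        refine prodExp_pairPotential_le hq hg hg1 hε h.eps_card hy1 hy2 hij (h.upper y i hy1 hy2 hy3)
          (h.upper y j hy1 hy2 hy3) fun hi hj => ?_
        rcases le_total (fractionalPopulation y i) (fractionalPopulation y j) with h' | h'
        · exact Or.inl (h.lower y j i (Ne.symm hij) hy2 hi h')
        · exact Or.inr (h.lower y i j hij hy2 hj h')) t x
  -- There are at most `n ^ 2` pairs, and since `U ≤ 1` and `H ≤ n ^ 2`, each potential is at most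
  -- `n`.
  have h2 : Ψ x ≤ n ^ 3 := by
    have h3 : ∀ i j, (if i = j then 0 else pairPotential g ε i j x) ≤ n := fun i j => by
      split_ifs
      · exact hn.le
      have hU0 : 0 ≤ min (min (fractionalPopulation x i) (fractionalPopulation x j))
          (7 / 10 * g) := le_min (le_min (fractionalPopulation_nonneg x i)
            (fractionalPopulation_nonneg x j)) (by positivity)
      have hU1 : min (min (fractionalPopulation x i) (fractionalPopulation x j))
          (7 / 10 * g) ≤ 1 := (min_le_right _ _).trans (by linarith)
      have hH1 : 1 / (ε + (fractionalPopulation x i - fractionalPopulation x j) ^ 2) ≤ n ^ 2 := by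
        rw [div_le_iff₀ (by positivity)]
        nlinarith [h.eps_card, mul_nonneg (sq_nonneg n)
          (sq_nonneg (fractionalPopulation x i - fractionalPopulation x j))]
      refine le_of_pow_le_pow_left₀ (n := 4) (by norm_num) hn.le ?_
      rw [pairPotential, geomMean_pow_four hU0 (by positivity)]
      calc _ ≤ 1 ^ 3 * n ^ 2 := by gcongr
        _ ≤ n ^ 4 := by rw [one_pow, one_mul]; exact pow_le_pow_right₀ (by linarith) (by norm_num)
    calc Ψ x ≤ ∑ i : Fin k, ∑ j : Fin k, n := Finset.sum_le_sum fun i _ =>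
          Finset.sum_le_sum fun j _ => h3 i j
      _ = k * (k * n) := by simp
      _ ≤ n * (n * n) := by
          have : (k : ℝ) ≤ n := by rw [hn']; exact_mod_cast hkn
          gcongr
      _ = n ^ 3 := by ring
  have hr : 0 ≤ (1 - g / 500000 / 4) ^ t := pow_nonneg (by linarith) t
  have h3 : 1 / n * avoid (lawMatrix q) D t x ≤ (1 - g / 500000 / 4) ^ t * n ^ 3 :=
    h1.trans (mul_le_mul_of_nonneg_left h2 hr)
  rw [one_div, inv_mul_le_iff₀ hn] at h3
  refine h3.trans (le_of_eq ?_)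
  rw [div_div]
  norm_num
  ring

/-- Within `t₁ + t₂` rounds, the chain reaches consensus or multiplies `gammaNorm` by `6 / 5`,
except with the probability given. -/
theorem avoid_consensus_or_growth_le [Nonempty V] (hq : IsOpinionLaw q) {g ε l : ℝ} (hl : 0 ≤ l)
    (hkn : k ≤ Fintype.card V) (h : FluctuationBounds q g ε l) {x : V → Fin k}
    (hx : g ≤ gammaNorm x) (t₁ t₂ : ℕ) :
    avoid (lawMatrix q) (fun y => IsConsensus y ∨ 6 / 5 * g ≤ gammaNorm y) (t₁ + t₂) x ≤
      Real.exp (-(Fintype.card V * g / 40)) +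
        (Fintype.card V : ℝ) ^ 4 * (1 - g / 2000000) ^ t₁ +
        (Real.exp (-(l * g / 2)) + 2 / g ^ 2 * (1 - g / 20) ^ t₂) := by
  have hK := isStochastic_lawMatrix hq
  have hg := h.pos
  have hg1 := h.le_one
  have hn : (0 : ℝ) < Fintype.card V := by exact_mod_cast Fintype.card_pos
  set n : ℝ := (Fintype.card V : ℝ) with hn'
  set D : (V → Fin k) → Prop := fun y => IsConsensus y ∨ 6 / 5 * g ≤ gammaNorm y with hD
  set B : (V → Fin k) → Prop := fun y => gammaNorm y < 9 / 10 * g with hB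
  have h1 := avoid_le_avoid_or_add (D := D) (B := B) hK
    (h := fun y => Real.exp (-(n / 4 * gammaNorm y)) * Real.exp (n / 4 * (9 / 10 * g)))
    (fun y => by positivity) (fun y hy => by
      rw [← Real.exp_add]
      refine Real.one_le_exp ?_
      nlinarith [hy.le]) (fun y _ _ => by
      rw [sum_lawMatrix_mul]
      simp_rw [mul_comm _ (Real.exp (n / 4 * (9 / 10 * g)))]
      rw [prodExp_const_mul]
      exact mul_le_mul_of_nonneg_left (hq.exp_gammaNorm y) (Real.exp_pos _).le) (t₁ + t₂) x
  have h2 : Real.exp (-(n / 4 * gammaNorm x)) * Real.exp (n / 4 * (9 / 10 * g)) ≤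
      Real.exp (-(n * g / 40)) := by
    rw [← Real.exp_add]
    exact Real.exp_le_exp.2 (by nlinarith)
  have hδ : 0 ≤ Real.exp (-(l * g / 2)) + 2 / g ^ 2 * (1 - g / 20) ^ t₂ :=
    add_nonneg (Real.exp_pos _).le (mul_nonneg (by positivity) (pow_nonneg (by linarith) _))
  -- A large opinion is treated as an intermediate target: within `t₁` rounds it appears or the pair
  -- potentials end the stage, and after its appearance `t₂` further rounds are enough.
  have h3 := avoid_add_le (D := fun y => D y ∨ B y) (G := fun y => ∃ i, 2 * g < fractionalPopulation y i)
    hK hδ (t₂ := t₂) (fun y _ hy => by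
      obtain ⟨i, hi⟩ := hy
      exact avoid_le_of_large hq hl h
        (fun z hz => not_le.1 fun hz' => hz (Or.inl (Or.inr hz'))) hi.le t₂) t₁ x
  have h4 := avoid_le_of_pairs hq hkn h
    (D := fun y => (D y ∨ B y) ∨ ∃ i, 2 * g < fractionalPopulation y i) (fun y hy => by
      refine ⟨fun h => hy (Or.inl (Or.inl (Or.inl h))), not_lt.1 fun h => hy (Or.inl (Or.inr h)),
        not_le.1 fun h => hy (Or.inl (Or.inl (Or.inr h))), fun j => not_lt.1 fun h => hy (Or.inr ⟨j, h⟩)⟩)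
    t₁ x
  linarith

end Stage

/-! ### The one-round laws of 3-Majority and 2-Choices -/

section Laws

variable {V : Type*} [Fintype V] [DecidableEq V] [Nonempty V] {k : ℕ}

theorem toReal_map_uniform_pi {R ι : Type*} [Fintype R] [Nonempty R] [DecidableEq ι]
    (r : V → R → ι) (y : V → ι) :
    (((PMF.uniformOfFintype (V → R)).map fun w v => r v (w v)) y).toReal =
      ∏ v, (∑ w, if r v w = y v then 1 else 0) / (Fintype.card R : ℝ) := by
  classical
  rw [PMF.map_apply, tsum_fintype, ENNReal.toReal_sum fun w _ => by
    split_ifs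
    · exact PMF.apply_ne_top _ _
    · exact ENNReal.zero_ne_top]
  have h1 : ∀ w : V → R, (if y = (fun v => r v (w v)) then
      (PMF.uniformOfFintype (V → R)) w else 0).toReal =
      ∏ v, (if r v (w v) = y v then 1 else 0) / (Fintype.card R : ℝ) := by
    intro w
    rw [Finset.prod_div_distrib, Finset.prod_const, Finset.card_univ]
    by_cases h : y = fun v => r v (w v)
    · rw [if_pos h, PMF.uniformOfFintype_apply, Finset.prod_eq_one fun v _ => by
        rw [if_pos (congrFun h v).symm]]
      simp
    · rw [if_neg h]
      obtain ⟨v, hv⟩ := Function.ne_iff.1 h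
      rw [Finset.prod_eq_zero (Finset.mem_univ v) (if_neg (Ne.symm hv)), zero_div]
      rfl
  simp only [Finset.sum_div]
  rw [Finset.prod_univ_sum, Fintype.piFinset_univ]
  exact Finset.sum_congr rfl fun w _ => by convert h1 w

theorem sum_pi_prod {κ : Type*} [Fintype κ] [DecidableEq κ] (f : κ → V → ℝ) :
    ∑ w : κ → V, ∏ j, f j (w j) = ∏ j, ∑ u, f j u := by
  rw [Finset.prod_univ_sum, Fintype.piFinset_univ]

theorem sum_ite_eq_card_mul (x : V → Fin k) (i : Fin k) :
    ∑ u, (if x u = i then (1 : ℝ) else 0) = Fintype.card V * fractionalPopulation x i := by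
  have hn : (Fintype.card V : ℝ) ≠ 0 := by exact_mod_cast Fintype.card_ne_zero
  rw [Finset.sum_boole, fractionalPopulation]
  field_simp

/-- The law of the next opinion of a vertex in 3-Majority. -/
def threeMajorityLaw (x : V → Fin k) (_ : V) (i : Fin k) : ℝ :=
  fractionalPopulation x i * (1 + fractionalPopulation x i - gammaNorm x)

/-- The law of the next opinion of the vertex `v` in 2-Choices. -/
def twoChoicesLaw (x : V → Fin k) (v : V) (i : Fin k) : ℝ :=
  fractionalPopulation x i ^ 2 + (if x v = i then 1 - gammaNorm x else 0)

theorem toReal_threeMajorityStep (x y : V → Fin k) :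
    (threeMajorityStep x y).toReal = lawMatrix threeMajorityLaw x y := by
  have hn : (Fintype.card V : ℝ) ≠ 0 := by exact_mod_cast Fintype.card_ne_zero
  refine (toReal_map_uniform_pi (fun _ (w : Fin 3 → V) =>
    if x (w 0) = x (w 1) then x (w 0) else x (w 2)) y).trans (Finset.prod_congr rfl fun v _ => ?_)
  set i := y v
  -- The indicator of the new opinion is written as a combination of products over the three
  -- samples, so that its sum over all samples factorises: both first samples equal `i`, plus the
  -- third equals `i`, minus the third equals `i` while the first two agree.
  have h1 : ∀ w : Fin 3 → V, (if (if x (w 0) = x (w 1) then x (w 0) else x (w 2)) = i then 1 else 0) =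
      (∏ j, (![fun u => if x u = i then 1 else 0, fun u => if x u = i then 1 else 0, fun _ => 1] :
        Fin 3 → V → ℝ) j (w j)) +
      (∏ j, (![fun _ => 1, fun _ => 1, fun u => if x u = i then 1 else 0] : Fin 3 → V → ℝ) j (w j)) -
      ∑ c, ∏ j, (![fun u => if x u = c then 1 else 0, fun u => if x u = c then 1 else 0,
        fun u => if x u = i then 1 else 0] : Fin 3 → V → ℝ) j (w j) := by
    intro w
    have hs : ∑ c, (if x (w 0) = c then (1 : ℝ) else 0) * (if x (w 1) = c then 1 else 0) *
        (if x (w 2) = i then 1 else 0) = (if x (w 0) = x (w 1) then 1 else 0) *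
        (if x (w 2) = i then 1 else 0) := by
      rw [← Finset.sum_mul]; simp [eq_comm]
    simp only [Fin.prod_univ_three, Matrix.cons_val_zero, Matrix.cons_val_one, Matrix.cons_val,
      one_mul, mul_one, hs]
    by_cases h : x (w 0) = x (w 1)
    · rw [if_pos h, if_pos h, ← h]; split_ifs <;> simp
    · rw [if_neg h, if_neg h]
      by_cases h2 : x (w 0) = i
      · have h3 : x (w 1) ≠ i := fun h3 => h (h2.trans h3.symm)
        simp [h3]
      · simp [h2]
  simp only [h1, Finset.sum_sub_distrib, Finset.sum_add_distrib]
  rw [Finset.sum_comm, sum_pi_prod, sum_pi_prod]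
  simp only [sum_pi_prod]
  simp only [Fin.prod_univ_three, Matrix.cons_val_zero, Matrix.cons_val_one,
    Matrix.cons_val, sum_ite_eq_card_mul, Finset.sum_const, Finset.card_univ, nsmul_eq_mul, mul_one,
    Fintype.card_fun, Fintype.card_fin, threeMajorityLaw]
  have h2 : ∑ c, (Fintype.card V : ℝ) * fractionalPopulation x c *
      (Fintype.card V * fractionalPopulation x c) * (Fintype.card V * fractionalPopulation x i) =
      (Fintype.card V : ℝ) ^ 3 * fractionalPopulation x i * gammaNorm x := by
    rw [gammaNorm, Finset.mul_sum]
    exact Finset.sum_congr rfl fun c _ => by ring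
  rw [h2]
  push_cast
  field_simp
  ring

theorem toReal_twoChoicesStep (x y : V → Fin k) :
    (twoChoicesStep x y).toReal = lawMatrix twoChoicesLaw x y := by
  have hn : (Fintype.card V : ℝ) ≠ 0 := by exact_mod_cast Fintype.card_ne_zero
  refine (toReal_map_uniform_pi (fun v (w : Fin 2 → V) =>
    if x (w 0) = x (w 1) then x (w 0) else x v) y).trans (Finset.prod_congr rfl fun v _ => ?_)
  set i := y v
  have h1 : ∀ w : Fin 2 → V, (if (if x (w 0) = x (w 1) then x (w 0) else x v) = i then 1 else 0) =
      (∏ j, (![fun u => if x u = i then 1 else 0, fun u => if x u = i then 1 else 0] :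
        Fin 2 → V → ℝ) j (w j)) +
      (if x v = i then 1 else 0) * (1 -
      ∑ c, ∏ j, (![fun u => if x u = c then 1 else 0, fun u => if x u = c then 1 else 0] :
        Fin 2 → V → ℝ) j (w j)) := by
    intro w
    have hs : ∑ c, (if x (w 0) = c then (1 : ℝ) else 0) * (if x (w 1) = c then 1 else 0) =
        (if x (w 0) = x (w 1) then 1 else 0) := by simp [eq_comm]
    simp only [Fin.prod_univ_two, Matrix.cons_val_zero, Matrix.cons_val_one, hs]
    by_cases h : x (w 0) = x (w 1)
    · rw [if_pos h, if_pos h, ← h]; split_ifs <;> simp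
    · rw [if_neg h, if_neg h]
      by_cases h2 : x (w 0) = i
      · have h3 : x (w 1) ≠ i := fun h3 => h (h2.trans h3.symm)
        simp [h3]
      · simp [h2]
  simp only [h1, Finset.sum_add_distrib, ← Finset.mul_sum, Finset.sum_sub_distrib]
  rw [Finset.sum_comm, sum_pi_prod]
  simp only [sum_pi_prod]
  simp only [Fin.prod_univ_two, Matrix.cons_val_zero, Matrix.cons_val_one,
    sum_ite_eq_card_mul, Finset.sum_const, Finset.card_univ, nsmul_eq_mul, mul_one,
    Fintype.card_fun, Fintype.card_fin, twoChoicesLaw]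
  have h2 : ∑ c, (Fintype.card V : ℝ) * fractionalPopulation x c *
      (Fintype.card V * fractionalPopulation x c) = (Fintype.card V : ℝ) ^ 2 * gammaNorm x := by
    rw [gammaNorm, Finset.mul_sum]
    exact Finset.sum_congr rfl fun c _ => by ring
  rw [h2]
  push_cast
  split_ifs
  · field_simp
  · field_simp
    ring

/-- Linearisation: by `‖a‖² + ‖b‖² ≥ 2⟨a, b⟩`, the next `γ` is bounded below by an affine function
of the next populations, which is a sum of independent terms `α (y v)`. The Laplace bound with `u =
1/2` then needs a second moment of at most twice the drift. The centring `b v` is free up to its sum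
and is chosen to keep the second moment small. -/
theorem prodExp_exp_gammaNorm_le {q : V → Fin k → ℝ} (hq : IsLaw q) (x : V → Fin k) (b : V → ℝ)
    (hb0 : ∀ v, 0 ≤ b v) (hb1 : ∀ v, b v ≤ 1) (hb : ∑ v, b v = Fintype.card V * gammaNorm x)
    (h : ∑ v, ∑ c, q v c * (fractionalPopulation x c - b v) ^ 2 ≤
      2 * ∑ v, ∑ c, q v c * (fractionalPopulation x c - b v)) :
    prodExp q (fun y => Real.exp (-(Fintype.card V / 4 * gammaNorm y))) ≤
      Real.exp (-(Fintype.card V / 4 * gammaNorm x)) := by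
  have hn : (0 : ℝ) < Fintype.card V := by exact_mod_cast Fintype.card_pos
  have h1 : ∀ y : V → Fin k, Real.exp (-(Fintype.card V / 4 * gammaNorm y)) ≤
      Real.exp (-(Fintype.card V / 4 * gammaNorm x)) *
        Real.exp (-(1 / 2 * ∑ v, (fractionalPopulation x (y v) - b v))) := fun y => by
    rw [← Real.exp_add, Real.exp_le_exp, Finset.sum_sub_distrib, hb, sum_comp_eq_card_mul]
    have h2 : 2 * ∑ i, fractionalPopulation y i * fractionalPopulation x i ≤
        gammaNorm y + gammaNorm x := by
      rw [gammaNorm, gammaNorm, Finset.mul_sum, ← Finset.sum_add_distrib]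
      exact Finset.sum_le_sum fun i _ => by
        nlinarith [sq_nonneg (fractionalPopulation y i - fractionalPopulation x i)]
    nlinarith [mul_le_mul_of_nonneg_left h2 hn.le]
  refine (prodExp_mono hq h1).trans ?_
  rw [prodExp_const_mul]
  refine mul_le_of_le_one_right (Real.exp_pos _).le ?_
  refine (prodExp_exp_neg_sum_le hq (fun v c => fractionalPopulation x c - b v) (u := 1 / 2)
    fun v c => ?_).trans ?_
  · rw [abs_le]
    constructor <;> linarith [fractionalPopulation_nonneg x c, fractionalPopulation_le_one x c,
      hb0 v, hb1 v]
  · exact Real.exp_le_one_iff.2 (by linarith)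

/-- The Laplace bound for the number of supporters of `i`, centred at `b v`; the drift must dominate
`u` times the second moment. -/
theorem prodExp_exp_fractionalPopulation_le {q : V → Fin k → ℝ} (hq : IsLaw q) (x : V → Fin k)
    (i : Fin k) (b : V → ℝ) (hb0 : ∀ v, 0 ≤ b v) (hb1 : ∀ v, b v ≤ 1)
    (hb : ∑ v, b v = Fintype.card V * fractionalPopulation x i) {u : ℝ} (hu : 0 ≤ u) (hu1 : u ≤ 1)
    (h : u * ∑ v, (q v i * (1 - b v) ^ 2 + (1 - q v i) * b v ^ 2) ≤ ∑ v, (q v i - b v)) :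
    prodExp q (fun y => Real.exp (-(u * Fintype.card V * fractionalPopulation y i))) ≤
      Real.exp (-(u * Fintype.card V * fractionalPopulation x i)) := by
  have h1 : ∀ y : V → Fin k, Real.exp (-(u * Fintype.card V * fractionalPopulation y i)) =
      Real.exp (-(u * Fintype.card V * fractionalPopulation x i)) *
        Real.exp (-(u * ∑ v, ((if y v = i then 1 else 0) - b v))) := fun y => by
    rw [← Real.exp_add, Finset.sum_sub_distrib, hb, sum_ite_eq_card_mul]
    congr 1
    ring
  rw [funext h1, prodExp_const_mul]
  refine mul_le_of_le_one_right (Real.exp_pos _).le ?_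
  refine (prodExp_exp_neg_sum_le hq (fun v c => (if c = i then 1 else 0) - b v) (u := u)
    fun v c => ?_).trans (Real.exp_le_one_iff.2 ?_)
  · rw [abs_mul, abs_of_nonneg hu]
    refine mul_le_one₀ hu1 (abs_nonneg _) ?_
    rw [abs_le]
    split_ifs <;> constructor <;> linarith [hb0 v, hb1 v]
  · have e1 : ∀ v, ∑ c, q v c * ((if c = i then 1 else 0) - b v) = q v i - b v := fun v => by
      simp [mul_sub, ← Finset.sum_mul, hq.sum_eq_one]
    have e2 : ∀ v, ∑ c, q v c * ((if c = i then 1 else 0) - b v) ^ 2 =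
        q v i * (1 - b v) ^ 2 + (1 - q v i) * b v ^ 2 := fun v => by
      have : ∀ c, q v c * ((if c = i then 1 else 0) - b v) ^ 2 =
          (if c = i then q v c else 0) * (1 - 2 * b v) + q v c * b v ^ 2 := fun c => by
        split_ifs <;> ring
      simp only [this, Finset.sum_add_distrib, ← Finset.sum_mul, hq.sum_eq_one]
      simp
      ring
    simp only [e1, e2]
    nlinarith

theorem isLaw_threeMajorityLaw (x : V → Fin k) : IsLaw (threeMajorityLaw x) where
  nonneg v c := mul_nonneg (fractionalPopulation_nonneg x c) (by
    linarith [fractionalPopulation_nonneg x c, gammaNorm_le_one x])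
  sum_eq_one v := by
    have : ∀ c, threeMajorityLaw x v c = fractionalPopulation x c * (1 - gammaNorm x) +
      fractionalPopulation x c ^ 2 := fun c => by rw [threeMajorityLaw]; ring
    simp only [this, Finset.sum_add_distrib, ← Finset.sum_mul, sum_fractionalPopulation]
    rw [← gammaNorm]; ring

theorem isOpinionLaw_threeMajorityLaw : IsOpinionLaw (threeMajorityLaw (V := V) (k := k)) where
  law x := isLaw_threeMajorityLaw x
  mean x i := by simp [threeMajorityLaw]
  exp_gammaNorm x := by
    refine prodExp_exp_gammaNorm_le (isLaw_threeMajorityLaw x) x (fun _ => gammaNorm x) (fun _ => gammaNorm_nonneg x)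
      (fun _ => gammaNorm_le_one x) (by simp) ?_
    rw [Finset.mul_sum]
    refine Finset.sum_le_sum fun v _ => ?_
    -- The drift is the variance of `α` under the law `α` itself; the second moment is at most twice
    -- this, because `threeMajorityLaw ≤ 2 * α`.
    have h1 : ∑ c, threeMajorityLaw x v c * (fractionalPopulation x c - gammaNorm x) =
        ∑ c, fractionalPopulation x c * (fractionalPopulation x c - gammaNorm x) ^ 2 := by
      have : ∀ c, threeMajorityLaw x v c * (fractionalPopulation x c - gammaNorm x) =
          fractionalPopulation x c * (fractionalPopulation x c - gammaNorm x) ^ 2 +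
          (fractionalPopulation x c ^ 2 - fractionalPopulation x c * gammaNorm x) := fun c => by
        rw [threeMajorityLaw]; ring
      simp only [this, Finset.sum_add_distrib, Finset.sum_sub_distrib, ← Finset.sum_mul,
        sum_fractionalPopulation]
      rw [← gammaNorm]; ring
    rw [h1, Finset.mul_sum]
    refine Finset.sum_le_sum fun c _ => ?_
    have h2 : threeMajorityLaw x v c ≤ fractionalPopulation x c * 2 :=
      mul_le_mul_of_nonneg_left (by linarith [fractionalPopulation_le_one x c, gammaNorm_nonneg x])
        (fractionalPopulation_nonneg x c)
    nlinarith [mul_le_mul_of_nonneg_right h2 (sq_nonneg (fractionalPopulation x c - gammaNorm x))]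

theorem isLaw_twoChoicesLaw (x : V → Fin k) : IsLaw (twoChoicesLaw x) where
  nonneg v c := by
    unfold twoChoicesLaw
    have := gammaNorm_le_one x
    split_ifs
    · nlinarith [sq_nonneg (fractionalPopulation x c)]
    · positivity
  sum_eq_one v := by
    simp only [twoChoicesLaw, Finset.sum_add_distrib]
    rw [← gammaNorm]
    simp

theorem isOpinionLaw_twoChoicesLaw : IsOpinionLaw (twoChoicesLaw (V := V) (k := k)) where
  law x := isLaw_twoChoicesLaw x
  mean x i := by
    have : ∀ v, twoChoicesLaw x v i = fractionalPopulation x i ^ 2 +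
      (if x v = i then 1 else 0) * (1 - gammaNorm x) := fun v => by
        rw [twoChoicesLaw]; split_ifs <;> ring
    simp only [this, Finset.sum_add_distrib, ← Finset.sum_mul, sum_ite_eq_card_mul]
    simp
    ring
  exp_gammaNorm x := by
    -- Centring at the population of the current opinion makes the term of a vertex that keeps its
    -- opinion vanish.
    refine prodExp_exp_gammaNorm_le (isLaw_twoChoicesLaw x) x (fun v => fractionalPopulation x (x v))
      (fun v => fractionalPopulation_nonneg x _) (fun v => fractionalPopulation_le_one x _) ?_ ?_
    · rw [sum_comp_eq_card_mul, gammaNorm]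
      congr 1
      exact Finset.sum_congr rfl fun i _ => by ring
    set a := fractionalPopulation x with ha
    have h1 : ∀ v, ∑ c, twoChoicesLaw x v c * (a c - a (x v)) ^ 2 =
        ∑ c, a c ^ 2 * (a c - a (x v)) ^ 2 := fun v => Finset.sum_congr rfl fun c _ => by
      rw [twoChoicesLaw]
      by_cases h : x v = c
      · rw [h]; ring
      · rw [if_neg h, add_zero]
    have h2 : ∀ v, ∑ c, twoChoicesLaw x v c * (a c - a (x v)) =
        ∑ c, a c ^ 2 * (a c - a (x v)) := fun v => Finset.sum_congr rfl fun c _ => by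
      rw [twoChoicesLaw]
      by_cases h : x v = c
      · rw [h]; ring
      · rw [if_neg h, add_zero]
    simp only [h1, h2]
    rw [sum_comp_eq_card_mul x (fun j => ∑ c, a c ^ 2 * (a c - a j) ^ 2),
      sum_comp_eq_card_mul x (fun j => ∑ c, a c ^ 2 * (a c - a j)), ← ha]
    have h3 : ∑ j, a j * ∑ c, a c ^ 2 * (a c - a j) = ∑ j, ∑ c, a j * (a c ^ 2 * (a c - a j)) :=
      Finset.sum_congr rfl fun j _ => Finset.mul_sum _ _ _
    -- Symmetrising in `j` and `c` turns the drift into a sum of squares.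
    have h4 : 2 * ∑ j, a j * ∑ c, a c ^ 2 * (a c - a j) =
        ∑ j, ∑ c, a j * a c * (a c - a j) ^ 2 := by
      have hsw : ∑ j, ∑ c, a j * (a c ^ 2 * (a c - a j)) = ∑ j, ∑ c, a c * (a j ^ 2 * (a j - a c)) :=
        Finset.sum_comm
      rw [two_mul]
      nth_rewrite 2 [h3]
      rw [hsw, h3, ← Finset.sum_add_distrib]
      refine Finset.sum_congr rfl fun j _ => ?_
      rw [← Finset.sum_add_distrib]
      exact Finset.sum_congr rfl fun c _ => by ring
    have h5 : ∑ j, a j * ∑ c, a c ^ 2 * (a c - a j) ^ 2 ≤ ∑ j, ∑ c, a j * a c * (a c - a j) ^ 2 := by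
      refine Finset.sum_le_sum fun j _ => ?_
      rw [Finset.mul_sum]
      refine Finset.sum_le_sum fun c _ => ?_
      have h0 : 0 ≤ a j * a c * (a c - a j) ^ 2 :=
        mul_nonneg (mul_nonneg (fractionalPopulation_nonneg x j) (fractionalPopulation_nonneg x c))
          (sq_nonneg _)
      nlinarith [mul_le_mul_of_nonneg_left (fractionalPopulation_le_one x c) h0]
    rw [mul_left_comm, h4]
    exact mul_le_mul_of_nonneg_left h5 (Nat.cast_nonneg _)

/-- The variance of a population of order `g` is of order `g / n`, hence `ε` of order `1 / n`. The
second moment of a vertex is at most `3 * α i` against a drift `α i * (α i - γ) ≥ 3/10 * g * α i`,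
which gives `u = g / 10`. This is why `g ^ 2 * n` has to be large. -/
theorem fluctuationBounds_threeMajorityLaw {g : ℝ} (hg : 0 < g) (hg1 : g ≤ 1)
    (hn : 10240 ≤ Fintype.card V) (hgn : 5120 ≤ g ^ 2 * Fintype.card V) :
    FluctuationBounds (threeMajorityLaw (V := V) (k := k)) g (10240 / Fintype.card V)
      (g / 10 * Fintype.card V) := by
  have hn' : (10240 : ℝ) ≤ Fintype.card V := by exact_mod_cast hn
  set n : ℝ := (Fintype.card V : ℝ) with hndef
  have hn0 : 0 < n := by linarith
  have hvar : ∀ (x : V → Fin k) i, populationVariance threeMajorityLaw x i =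
      fractionalPopulation x i * (1 + fractionalPopulation x i - gammaNorm x) *
        (1 - fractionalPopulation x i * (1 + fractionalPopulation x i - gammaNorm x)) / n :=
    fun x i => by
      simp only [populationVariance, threeMajorityLaw, Finset.sum_const, Finset.card_univ,
        nsmul_eq_mul, ← hndef]
      field_simp
  have hle : ∀ (x : V → Fin k) i, populationVariance threeMajorityLaw x i ≤
      2 * fractionalPopulation x i / n := fun x i => by
    rw [hvar]
    refine div_le_div_of_nonneg_right ?_ hn0.le
    have h0 := (isLaw_threeMajorityLaw x).nonneg (Classical.arbitrary V) i
    rw [threeMajorityLaw] at h0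
    have h1 : fractionalPopulation x i * (1 + fractionalPopulation x i - gammaNorm x) ≤
        fractionalPopulation x i * 2 :=
      mul_le_mul_of_nonneg_left (by linarith [fractionalPopulation_le_one x i, gammaNorm_nonneg x])
        (fractionalPopulation_nonneg x i)
    nlinarith
  refine ⟨hg, hg1, ?_, ?_, ?_, ?_, ?_, ?_, ?_⟩
  · nlinarith
  · rw [div_le_one hn0]; exact hn'
  · rw [← hndef]; field_simp; nlinarith
  · intro x i _ _ h
    calc 2560 * populationVariance threeMajorityLaw x i
        ≤ 2560 * (2 * (2 * g) / n) := by
          have := h i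
          gcongr
          exact (hle x i).trans (by gcongr)
      _ = g * (10240 / n) := by ring
  · intro x i j hij hx hj hji
    rw [hvar, mul_div_assoc', div_div, mul_comm n, ← div_div]
    gcongr
    set a := fractionalPopulation x i
    set b := fractionalPopulation x j
    set γ := gammaNorm x
    have h0 := (isLaw_threeMajorityLaw x).nonneg (Classical.arbitrary V)
    -- The less popular of two opinions is adopted with probability at most `1/2`, so its variance
    -- does not degenerate near consensus.
    have hsum : a * (1 + a - γ) + b * (1 + b - γ) ≤ 1 := by
      have h := (isLaw_threeMajorityLaw x).sum_eq_one (Classical.arbitrary V)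
      refine le_trans ?_ h.le
      exact (Finset.sum_pair hij).symm.le.trans (Finset.sum_le_univ_sum_of_nonneg h0)
    have hγ1 : γ ≤ 1 := gammaNorm_le_one x
    have hb0 : 0 ≤ b := fractionalPopulation_nonneg x j
    have hmono : b * (1 + b - γ) ≤ a * (1 + a - γ) :=
      mul_le_mul hji (by linarith) (by linarith) (hb0.trans hji)
    have h1 : 1 / 2 ≤ 1 + b - γ := by linarith
    have h2 : 7 / 20 * g ≤ b * (1 + b - γ) := by nlinarith
    nlinarith
  · intro x i hx hi
    have hi0 : 0 < fractionalPopulation x i := by linarith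
    constructor
    · refine (mul_le_mul_of_nonneg_left (hle x i) (by norm_num)).trans ?_
      rw [mul_div_assoc', div_le_iff₀ hn0]
      have h1 : 5120 ≤ g * fractionalPopulation x i * n := by
        have : g * g ≤ g * fractionalPopulation x i := by gcongr; linarith
        nlinarith [mul_le_mul_of_nonneg_right this hn0.le]
      nlinarith [mul_le_mul_of_nonneg_right h1 hi0.le]
    · refine (hle x i).trans ?_
      rw [div_le_div_iff₀ hn0 (by norm_num)]
      nlinarith [fractionalPopulation_le_one x i]
  · intro x i hx hi
    have hi0 : 0 ≤ fractionalPopulation x i := by linarith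
    refine prodExp_exp_fractionalPopulation_le (isLaw_threeMajorityLaw x) x i
      (fun _ => fractionalPopulation x i) (fun _ => hi0) (fun _ => fractionalPopulation_le_one x i)
      (by simp) (by positivity) (by linarith) ?_
    rw [Finset.mul_sum]
    refine Finset.sum_le_sum fun v _ => ?_
    have h0 := (isLaw_threeMajorityLaw x).nonneg v i
    have h1 : threeMajorityLaw x v i ≤ 2 * fractionalPopulation x i := by
      rw [threeMajorityLaw]
      nlinarith [fractionalPopulation_le_one x i, gammaNorm_nonneg x]
    have ha1 := fractionalPopulation_le_one x i
    have h2 : threeMajorityLaw x v i * (1 - fractionalPopulation x i) ^ 2 +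
        (1 - threeMajorityLaw x v i) * fractionalPopulation x i ^ 2 ≤
        3 * fractionalPopulation x i := by nlinarith [mul_nonneg h0 hi0]
    calc _ ≤ g / 10 * (3 * fractionalPopulation x i) := by gcongr
      _ ≤ fractionalPopulation x i * (fractionalPopulation x i - gammaNorm x) := by nlinarith
      _ = _ := by rw [threeMajorityLaw]; ring

/-- Vertices mostly keep their opinions while `γ` is small, so the variance is only of order `g ^ 2
/ n` and `ε` of order `g / n`. Centred at the current indicator, the second moment is comparable to
the drift, so `u = 1/10` needs no factor `g`, and it is `g * n` that has to be large. -/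
theorem fluctuationBounds_twoChoicesLaw {g : ℝ} (hg : 0 < g) (hg1 : g ≤ 1)
    (hn : 16384 ≤ Fintype.card V) (hgn : 5120 ≤ g * Fintype.card V) :
    FluctuationBounds (twoChoicesLaw (V := V) (k := k)) g (16384 * g / Fintype.card V)
      (1 / 10 * Fintype.card V) := by
  have hn' : (16384 : ℝ) ≤ Fintype.card V := by exact_mod_cast hn
  set n : ℝ := (Fintype.card V : ℝ) with hndef
  have hn0 : 0 < n := by linarith
  have hvar : ∀ (x : V → Fin k) i, populationVariance twoChoicesLaw x i =
      (fractionalPopulation x i * ((1 - gammaNorm x + fractionalPopulation x i ^ 2) *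
        (gammaNorm x - fractionalPopulation x i ^ 2)) +
        (1 - fractionalPopulation x i) *
          (fractionalPopulation x i ^ 2 * (1 - fractionalPopulation x i ^ 2))) / n :=
    fun x i => by
      have : ∀ v, twoChoicesLaw x v i * (1 - twoChoicesLaw x v i) =
          (if x v = i then 1 else 0) * ((1 - gammaNorm x + fractionalPopulation x i ^ 2) *
            (gammaNorm x - fractionalPopulation x i ^ 2) -
            fractionalPopulation x i ^ 2 * (1 - fractionalPopulation x i ^ 2)) +
            fractionalPopulation x i ^ 2 * (1 - fractionalPopulation x i ^ 2) := fun v => by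
        rw [twoChoicesLaw]; split_ifs <;> ring
      simp only [populationVariance, this, Finset.sum_add_distrib, ← Finset.sum_mul,
        sum_ite_eq_card_mul, Finset.sum_const, Finset.card_univ, nsmul_eq_mul, ← hndef]
      field_simp
      ring
  have hsq := fun (x : V → Fin k) i => fractionalPopulation_sq_le_gammaNorm x i
  have hle : ∀ (x : V → Fin k) i, populationVariance twoChoicesLaw x i ≤
      (fractionalPopulation x i * gammaNorm x + fractionalPopulation x i ^ 2) / n := fun x i => by
    rw [hvar]
    have h0 := fractionalPopulation_nonneg x i
    have h1 := fractionalPopulation_le_one x i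
    have h2 := hsq x i
    have h3 := gammaNorm_le_one x
    gcongr
    · nlinarith [sq_nonneg (fractionalPopulation x i)]
    · have : fractionalPopulation x i ^ 2 * (1 - fractionalPopulation x i ^ 2) ≤
          fractionalPopulation x i ^ 2 := by nlinarith [sq_nonneg (fractionalPopulation x i ^ 2)]
      have h4 : 0 ≤ fractionalPopulation x i ^ 2 * (1 - fractionalPopulation x i ^ 2) :=
        mul_nonneg (sq_nonneg _) (by linarith)
      nlinarith
  refine ⟨hg, hg1, ?_, ?_, ?_, ?_, ?_, ?_, ?_⟩
  · have : 5120 * 5120 ≤ (g * n) * (g * n) := by gcongr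
    nlinarith
  · rw [div_le_one hn0]; nlinarith
  · rw [← hndef, show 16384 * g / n * n ^ 2 = 16384 * (g * n) by field_simp]; linarith
  · intro x i _ hx h
    calc 2560 * populationVariance twoChoicesLaw x i
        ≤ 2560 * ((2 * g * (6 / 5 * g) + (2 * g) ^ 2) / n) := by
          have := h i
          have h0 := fractionalPopulation_nonneg x i
          have h1 := gammaNorm_nonneg x
          refine mul_le_mul_of_nonneg_left ((hle x i).trans ?_) (by norm_num)
          gcongr
      _ = g * (16384 * g / n) := by ring
  · intro x i j hij hx hj hji
    rw [hvar, mul_div_assoc', div_div, mul_comm n, ← div_div]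
    gcongr
    set b := fractionalPopulation x j
    have hb0 : 0 ≤ b := fractionalPopulation_nonneg x j
    have hb2 : b ≤ 1 / 2 := by linarith [fractionalPopulation_add_le_one x hij]
    have h1 : 0 ≤ b * ((1 - gammaNorm x + b ^ 2) * (gammaNorm x - b ^ 2)) :=
      mul_nonneg hb0 (mul_nonneg (by nlinarith [gammaNorm_le_one x]) (sub_nonneg.2 (hsq x j)))
    have h2 : 49 / 100 * g ^ 2 ≤ b ^ 2 := by nlinarith
    have h3 : 3 / 4 ≤ 1 - b ^ 2 := by nlinarith
    have h4 : 49 / 100 * g ^ 2 * (3 / 4) ≤ b ^ 2 * (1 - b ^ 2) := by gcongr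
    have h5 : 1 / 2 * (49 / 100 * g ^ 2 * (3 / 4)) ≤ (1 - b) * (b ^ 2 * (1 - b ^ 2)) :=
      mul_le_mul (by linarith) h4 (by positivity) (by linarith)
    nlinarith [sq_nonneg g]
  · intro x i hx hi
    have hi0 : 0 < fractionalPopulation x i := by linarith
    have h1 : populationVariance twoChoicesLaw x i ≤ 2 * fractionalPopulation x i ^ 2 / n := by
      refine (hle x i).trans ?_
      gcongr
      nlinarith
    constructor
    · refine (mul_le_mul_of_nonneg_left h1 (by norm_num)).trans ?_
      rw [mul_div_assoc', div_le_iff₀ hn0]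
      nlinarith [mul_le_mul_of_nonneg_right hgn (sq_nonneg (fractionalPopulation x i))]
    · refine h1.trans ?_
      rw [div_le_div_iff₀ hn0 (by norm_num)]
      nlinarith [hsq x i]
  · intro x i hx hi
    have hi0 : 0 ≤ fractionalPopulation x i := by linarith
    refine prodExp_exp_fractionalPopulation_le (isLaw_twoChoicesLaw x) x i
      (fun v => if x v = i then 1 else 0) (fun v => by split_ifs <;> norm_num)
      (fun v => by split_ifs <;> norm_num) (sum_ite_eq_card_mul x i) (by norm_num) (by norm_num) ?_
    rw [Finset.sum_sub_distrib, isOpinionLaw_twoChoicesLaw.mean, sum_ite_eq_card_mul]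
    have e : ∀ v, twoChoicesLaw x v i * (1 - (if x v = i then 1 else 0)) ^ 2 +
        (1 - twoChoicesLaw x v i) * (if x v = i then 1 else 0) ^ 2 =
        (if x v = i then 1 else 0) * (gammaNorm x - 2 * fractionalPopulation x i ^ 2) +
        fractionalPopulation x i ^ 2 := fun v => by
      rw [twoChoicesLaw]; split_ifs <;> ring
    simp only [e, Finset.sum_add_distrib, ← Finset.sum_mul, sum_ite_eq_card_mul, Finset.sum_const,
      Finset.card_univ, nsmul_eq_mul]
    have h2 : 1 / 10 * (fractionalPopulation x i * (gammaNorm x - 2 * fractionalPopulation x i ^ 2) +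
        fractionalPopulation x i ^ 2) ≤
        fractionalPopulation x i * (fractionalPopulation x i - gammaNorm x) := by
      nlinarith [pow_nonneg hi0 3]
    have h3 := mul_le_mul_of_nonneg_left h2 hn0.le
    rw [← hndef]
    linarith

end Laws

/-! ### Iterating the stages -/

section Stages

variable {V : Type*} [Fintype V] [DecidableEq V] [Nonempty V] {k : ℕ}
  {q : (V → Fin k) → V → Fin k → ℝ}

theorem mul_one_sub_pow_le {n r c : ℝ} {t m : ℕ} (hn : 0 < n) (hr1 : r ≤ 1)
    (hc : ((m : ℝ) + 2) * Real.log n ≤ r * t) (h : c ≤ n ^ m) :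
    c * (1 - r) ^ t ≤ 1 / n ^ 2 := by
  have h0 : 0 ≤ 1 - r := by linarith
  have h1 : (1 - r) ^ t ≤ Real.exp (-(r * t)) := by
    calc (1 - r) ^ t ≤ Real.exp (-r) ^ t :=
          pow_le_pow_left₀ h0 (by linarith [Real.add_one_le_exp (-r)]) t
      _ = Real.exp (-(r * t)) := by rw [← Real.exp_nat_mul]; congr 1; ring
  have h2 : Real.exp (-(r * t)) ≤ 1 / n ^ (m + 2) := by
    have : (1 : ℝ) / n ^ (m + 2) = Real.exp (-((m + 2 : ℕ) * Real.log n)) := by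
      rw [Real.exp_neg, Real.exp_nat_mul, Real.exp_log hn, one_div]
    rw [this]
    push_cast
    exact Real.exp_le_exp.2 (by linarith)
  calc c * (1 - r) ^ t ≤ n ^ m * (1 / n ^ (m + 2)) :=
        mul_le_mul h (h1.trans h2) (pow_nonneg h0 t) (by positivity)
    _ = 1 / n ^ 2 := by rw [pow_add]; field_simp

theorem exp_neg_le_one_div_sq {n r : ℝ} (hn : 0 < n) (h : 2 * Real.log n ≤ r) :
    Real.exp (-r) ≤ 1 / n ^ 2 := by
  have : (1 : ℝ) / n ^ 2 = Real.exp (-((2 : ℕ) * Real.log n)) := by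
    rw [Real.exp_neg, Real.exp_nat_mul, Real.exp_log hn, one_div]
  rw [this]
  push_cast
  exact Real.exp_le_exp.2 (by linarith)

theorem avoid_consensus_or_growth_le_of_log (hq : IsOpinionLaw q) {g ε l : ℝ}
    (hkn : k ≤ Fintype.card V) (hL : 1 ≤ Real.log (Fintype.card V))
    (h : FluctuationBounds q g ε l) (hgn : 80 * Real.log (Fintype.card V) ≤ g * Fintype.card V)
    (hl : 4 * Real.log (Fintype.card V) ≤ l * g) {x : V → Fin k} (hx : g ≤ gammaNorm x) :
    ∃ s : ℕ, (s : ℝ) ≤ 13000000 * (Real.log (Fintype.card V) / g) ∧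
      avoid (lawMatrix q) (fun y => IsConsensus y ∨ 6 / 5 * g ≤ gammaNorm y) s x ≤
        4 / (Fintype.card V : ℝ) ^ 2 := by
  have hg := h.pos
  have hg1 := h.le_one
  have hn : (0 : ℝ) < Fintype.card V := by exact_mod_cast Fintype.card_pos
  set n : ℝ := (Fintype.card V : ℝ) with hn'
  set L := Real.log n with hLdef
  have hLg : 1 ≤ L / g := by rw [le_div_iff₀ hg]; linarith
  have hl0 : 0 ≤ l := by
    by_contra hneg
    have := mul_neg_of_neg_of_pos (not_le.1 hneg) hg
    linarith
  -- The prefactors `n ^ 4` and `2 / g ^ 2 ≤ n ^ 2` call for `6 * L ≤ g * t₁ / 2000000` and `4 * L ≤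
  -- g * t₂ / 20` to leave `1 / n ^ 2` each.
  set t₁ := ⌈12000000 * (L / g)⌉₊ with ht₁
  set t₂ := ⌈80 * (L / g)⌉₊ with ht₂
  have h1 : 12000000 * (L / g) ≤ t₁ := Nat.le_ceil _
  have h2 : 80 * (L / g) ≤ t₂ := Nat.le_ceil _
  have h1' : (t₁ : ℝ) < 12000000 * (L / g) + 1 := Nat.ceil_lt_add_one (by positivity)
  have h2' : (t₂ : ℝ) < 80 * (L / g) + 1 := Nat.ceil_lt_add_one (by positivity)
  refine ⟨t₁ + t₂, by push_cast; linarith,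
    (avoid_consensus_or_growth_le hq hl0 hkn h hx t₁ t₂).trans ?_⟩
  have e : L / g * g = L := by field_simp
  have i1 : Real.exp (-(n * g / 40)) ≤ 1 / n ^ 2 := exp_neg_le_one_div_sq hn (by linarith)
  have i2 : n ^ 4 * (1 - g / 2000000) ^ t₁ ≤ 1 / n ^ 2 :=
    mul_one_sub_pow_le (m := 4) hn (by linarith)
      (by push_cast; nlinarith [mul_le_mul_of_nonneg_right h1 hg.le]) le_rfl
  have i3 : Real.exp (-(l * g / 2)) ≤ 1 / n ^ 2 := exp_neg_le_one_div_sq hn (by linarith)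
  have i4 : 2 / g ^ 2 * (1 - g / 20) ^ t₂ ≤ 1 / n ^ 2 := by
    refine mul_one_sub_pow_le (m := 2) hn (by linarith)
      (by push_cast; nlinarith [mul_le_mul_of_nonneg_right h2 hg.le]) ?_
    rw [div_le_iff₀ (by positivity)]
    linarith [h.card]
  calc _ ≤ 1 / n ^ 2 + 1 / n ^ 2 + (1 / n ^ 2 + 1 / n ^ 2) := by gcongr
    _ = 4 / n ^ 2 := by ring

/-- Here `m` bounds the number of remaining stages, since `γ ≤ 1`. The time budget closes because a
stage uses at most `13000000 * (L / g)` rounds and then needs `5/6 * 120000000 * (L / g)` more,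
which is below `120000000 * (L / g)` even after rounding. -/
theorem avoid_consensus_le (hq : IsOpinionLaw q) (hkn : k ≤ Fintype.card V)
    (hL : 1 ≤ Real.log (Fintype.card V)) {g₀ : ℝ}
    (hgn : 80 * Real.log (Fintype.card V) ≤ g₀ * Fintype.card V)
    (h : ∀ g, 0 < g → g₀ ≤ g → g ≤ 1 → ∃ ε l, FluctuationBounds q g ε l ∧
      4 * Real.log (Fintype.card V) ≤ l * g) (m : ℕ) (x : V → Fin k)
    (hx : g₀ ≤ gammaNorm x) (hm : 1 < gammaNorm x * (6 / 5) ^ m) {t : ℕ}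
    (ht : 120000000 * (Real.log (Fintype.card V) / gammaNorm x) ≤ t) :
    avoid (lawMatrix q) IsConsensus t x ≤ m * (4 / (Fintype.card V : ℝ) ^ 2) := by
  have hK := isStochastic_lawMatrix hq
  have hn : (0 : ℝ) < Fintype.card V := by exact_mod_cast Fintype.card_pos
  set n : ℝ := (Fintype.card V : ℝ) with hn'
  set L := Real.log n with hLdef
  induction m generalizing x t with
  | zero => linarith [gammaNorm_le_one x]
  | succ m ih =>
    set g := gammaNorm x with hgdef
    have hg1 : g ≤ 1 := gammaNorm_le_one x
    have hg : 0 < g := by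
      by_contra hneg
      have : g * (6 / 5) ^ (m + 1) ≤ 0 :=
        mul_nonpos_of_nonpos_of_nonneg (not_lt.1 hneg) (by positivity)
      linarith
    obtain ⟨ε, l, hF, hl⟩ := h g hg hx hg1
    obtain ⟨s, hs, hav⟩ := avoid_consensus_or_growth_le_of_log hq hkn hL hF
      (hgn.trans (by gcongr)) hl (x := x) le_rfl
    have hLg : 1 ≤ L / g := by rw [le_div_iff₀ hg]; linarith
    set t' := ⌈100000000 * (L / g)⌉₊ with ht'
    have h1 : 100000000 * (L / g) ≤ t' := Nat.le_ceil _
    have h1' : (t' : ℝ) < 100000000 * (L / g) + 1 := Nat.ceil_lt_add_one (by positivity)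
    have hst : s + t' ≤ t := by
      have : (s : ℝ) + t' ≤ t := by linarith
      exact_mod_cast this
    have h2 := avoid_add_le (D := IsConsensus) (G := fun y => 6 / 5 * g ≤ gammaNorm y) hK
      (δ := m * (4 / n ^ 2)) (t₂ := t') (by positivity) (fun y _ hy => by
        refine ih y (hx.trans (le_trans (by linarith) hy)) (hm.trans_le ?_) (le_trans ?_ h1)
        · calc g * (6 / 5) ^ (m + 1) = 6 / 5 * g * (6 / 5) ^ m := by ring
            _ ≤ gammaNorm y * (6 / 5) ^ m := by gcongr
        · have h3 : L / gammaNorm y ≤ L / (6 / 5 * g) := by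
            gcongr
          have h4 : L / (6 / 5 * g) = 5 / 6 * (L / g) := by field_simp
          rw [h4] at h3
          linarith) s x
    calc avoid (lawMatrix q) IsConsensus t x ≤ avoid (lawMatrix q) IsConsensus (s + t') x :=
          avoid_antitone hK x hst
      _ ≤ 4 / n ^ 2 + m * (4 / n ^ 2) := h2.trans (by gcongr)
      _ = ((m + 1 : ℕ) : ℝ) * (4 / n ^ 2) := by push_cast; ring

theorem avoid_consensus_le_div_card (hq : IsOpinionLaw q) (hkn : k ≤ Fintype.card V)
    (hL : 1 ≤ Real.log (Fintype.card V)) {g₀ : ℝ}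
    (hgn : 80 * Real.log (Fintype.card V) ≤ g₀ * Fintype.card V)
    (h : ∀ g, 0 < g → g₀ ≤ g → g ≤ 1 → ∃ ε l, FluctuationBounds q g ε l ∧
      4 * Real.log (Fintype.card V) ≤ l * g) (x : V → Fin k)
    (hx : g₀ ≤ gammaNorm x) {t : ℕ}
    (ht : 120000000 * (Real.log (Fintype.card V) / gammaNorm x) ≤ t) :
    avoid (lawMatrix q) IsConsensus t x ≤ 20 / (Fintype.card V : ℝ) := by
  have hn : (0 : ℝ) < Fintype.card V := by exact_mod_cast Fintype.card_pos
  -- By Bernoulli `(6/5) ^ (5 * n) ≥ 1 + n`, while `γ ≥ 1 / k ≥ 1 / n`. This crude count of stages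
  -- is affordable because each fails with probability at most `4 / n ^ 2`.
  have hm : 1 < gammaNorm x * (6 / 5) ^ (5 * Fintype.card V) := by
    have h1 : 1 ≤ Fintype.card V * gammaNorm x := by
      refine (one_le_mul_gammaNorm x).trans ?_
      have : (k : ℝ) ≤ Fintype.card V := by exact_mod_cast hkn
      have := gammaNorm_nonneg x
      gcongr
    have h2 := one_add_mul_le_pow (a := (1 / 5 : ℝ)) (by norm_num) (5 * Fintype.card V)
    push_cast at h2
    have h3 : (1 + 1 / 5 : ℝ) = 6 / 5 := by norm_num
    rw [h3] at h2
    have h4 : 0 < gammaNorm x := by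
      by_contra hneg
      have := mul_nonpos_of_nonneg_of_nonpos hn.le (not_lt.1 hneg)
      linarith
    nlinarith
  refine (avoid_consensus_le hq hkn hL hgn h _ x hx hm ht).trans (le_of_eq ?_)
  push_cast
  field_simp
  norm_num

end Stages

/-! ### Consensus times and the final statement -/

theorem ConsensusWithin.mono {V : Type u} {k : ℕ} {p : (V → Fin k) → PMF (V → Fin k)}
    {x₀ : V → Fin k} {T T' δ : ℝ} (h : ConsensusWithin.{u, v} p x₀ T δ) (hT : T ≤ T') :
    ConsensusWithin.{u, v} p x₀ T' δ := by
  intro Ω _ μ _ X hX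
  refine le_trans (measureReal_mono (fun ω hω => ?_)) (h Ω μ X hX)
  exact lt_of_le_of_lt (ENNReal.ofReal_le_ofReal hT) hω

theorem consensusWithin_of_one_le {V : Type u} {k : ℕ} {p : (V → Fin k) → PMF (V → Fin k)}
    {x₀ : V → Fin k} {T δ : ℝ} (hδ : 1 ≤ δ) : ConsensusWithin.{u, v} p x₀ T δ :=
  fun _ _ _ _ _ _ => measureReal_le_one.trans hδ

theorem consensusWithin_of_fluctuationBounds {V : Type u} [Fintype V] [DecidableEq V] [Nonempty V]
    {k : ℕ} {q : (V → Fin k) → V → Fin k → ℝ} {p : (V → Fin k) → PMF (V → Fin k)}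
    (hq : IsOpinionLaw q) (hp : ∀ x y, (p x y).toReal = lawMatrix q x y)
    (hkn : k ≤ Fintype.card V) {g₀ : ℝ} (x₀ : V → Fin k) (hx : g₀ ≤ gammaNorm x₀)
    (h : 16384 ≤ Fintype.card V → 1 ≤ Real.log (Fintype.card V) →
      80 * Real.log (Fintype.card V) ≤ g₀ * Fintype.card V ∧
      ∀ g, 0 < g → g₀ ≤ g → g ≤ 1 → ∃ ε l, FluctuationBounds q g ε l ∧
        4 * Real.log (Fintype.card V) ≤ l * g) :
    ConsensusWithin.{u, v} p x₀ (130000000 * (Real.log (Fintype.card V) / gammaNorm x₀))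
      (16384 * (Fintype.card V : ℝ) ^ (-1 : ℝ)) := by
  have hn : (0 : ℝ) < Fintype.card V := by exact_mod_cast Fintype.card_pos
  rw [Real.rpow_neg_one]
  -- For `n < 16384` the claimed probability bound exceeds `1`.
  rcases lt_or_ge (Fintype.card V) 16384 with hsmall | hlarge
  · refine consensusWithin_of_one_le ?_
    rw [← div_eq_mul_inv, le_div_iff₀ hn, one_mul]
    exact_mod_cast hsmall.le
  · have hlarge' : (16384 : ℝ) ≤ Fintype.card V := by exact_mod_cast hlarge
    have hL : 1 ≤ Real.log (Fintype.card V) := by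
      rw [Real.le_log_iff_exp_le hn]
      linarith [Real.exp_one_lt_three]
    obtain ⟨h1, h2⟩ := h hlarge hL
    have hγ : 0 < gammaNorm x₀ := by
      have := one_le_mul_gammaNorm x₀
      by_contra hneg
      have := mul_nonpos_of_nonneg_of_nonpos (Nat.cast_nonneg (α := ℝ) k) (not_lt.1 hneg)
      linarith
    have hLg : 1 ≤ Real.log (Fintype.card V) / gammaNorm x₀ := by
      rw [le_div_iff₀ hγ]; linarith [gammaNorm_le_one x₀]
    refine consensusWithin_of_avoid_le
      (t := ⌈120000000 * (Real.log (Fintype.card V) / gammaNorm x₀)⌉₊) ?_ ?_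
    · have := Nat.ceil_lt_add_one
        (a := 120000000 * (Real.log (Fintype.card V) / gammaNorm x₀)) (by positivity)
      linarith
    · simp only [hp]
      refine (avoid_consensus_le_div_card hq hkn hL h1 h2 x₀ hx (Nat.le_ceil _)).trans ?_
      rw [div_eq_mul_inv]
      gcongr
      norm_num

theorem consensusWithin_threeMajorityStep {V : Type u} [Fintype V] [DecidableEq V] [Nonempty V]
    {k : ℕ} (hkn : k ≤ Fintype.card V) (x₀ : V → Fin k)
    (hx : 100 * Real.log (Fintype.card V) / √(Fintype.card V : ℝ) ≤ gammaNorm x₀) :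
    ConsensusWithin.{u, v} threeMajorityStep x₀
      (130000000 * (Real.log (Fintype.card V) / gammaNorm x₀))
      (16384 * (Fintype.card V : ℝ) ^ (-1 : ℝ)) := by
  have hn : (0 : ℝ) < Fintype.card V := by exact_mod_cast Fintype.card_pos
  refine consensusWithin_of_fluctuationBounds isOpinionLaw_threeMajorityLaw toReal_threeMajorityStep
    hkn x₀ hx fun hlarge hL => ?_
  have hlarge' : (16384 : ℝ) ≤ Fintype.card V := by exact_mod_cast hlarge
  set n : ℝ := (Fintype.card V : ℝ)
  set L := Real.log n
  have hs : 0 < √n := Real.sqrt_pos.2 hn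
  have hs1 : 1 ≤ √n := Real.one_le_sqrt.2 (by linarith)
  have hss : √n * √n = n := Real.mul_self_sqrt hn.le
  constructor
  · calc 80 * L ≤ 100 * L * √n := by nlinarith
      _ = 100 * L / √n * (√n * √n) := by field_simp
      _ = 100 * L / √n * n := by rw [hss]
  · intro g hg hg0 hg1
    have h1 : 100 * L ≤ g * √n := by rwa [div_le_iff₀ hs] at hg0
    have h2 : 10000 * L ^ 2 ≤ g ^ 2 * n := by
      have : (100 * L) ^ 2 ≤ (g * √n) ^ 2 := by gcongr
      calc 10000 * L ^ 2 = (100 * L) ^ 2 := by ring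
        _ ≤ (g * √n) ^ 2 := this
        _ = g ^ 2 * n := by rw [mul_pow, sq (√n), hss]
    exact ⟨_, _, fluctuationBounds_threeMajorityLaw hg hg1 (by omega) (by nlinarith), by nlinarith⟩

theorem consensusWithin_twoChoicesStep {V : Type u} [Fintype V] [DecidableEq V] [Nonempty V]
    {k : ℕ} (hkn : k ≤ Fintype.card V) (x₀ : V → Fin k)
    (hx : 6000 * Real.log (Fintype.card V) ^ 2 / (Fintype.card V : ℝ) ≤ gammaNorm x₀) :
    ConsensusWithin.{u, v} twoChoicesStep x₀
      (130000000 * (Real.log (Fintype.card V) / gammaNorm x₀))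
      (16384 * (Fintype.card V : ℝ) ^ (-1 : ℝ)) := by
  have hn : (0 : ℝ) < Fintype.card V := by exact_mod_cast Fintype.card_pos
  refine consensusWithin_of_fluctuationBounds isOpinionLaw_twoChoicesLaw toReal_twoChoicesStep
    hkn x₀ hx fun hlarge hL => ?_
  set n : ℝ := (Fintype.card V : ℝ)
  set L := Real.log n
  constructor
  · rw [div_mul_cancel₀ _ hn.ne']
    nlinarith
  · intro g hg hg0 hg1
    have h1 : 6000 * L ^ 2 ≤ g * n := by rwa [div_le_iff₀ hn] at hg0
    exact ⟨_, _, fluctuationBounds_twoChoicesLaw hg hg1 hlarge (by nlinarith), by nlinarith⟩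

theorem inv_le_gammaNorm {V : Type*} [Fintype V] [Nonempty V] {k : ℕ} (x : V → Fin k) :
    0 < (k : ℝ) ∧ 1 / (k : ℝ) ≤ gammaNorm x := by
  obtain ⟨v⟩ := ‹Nonempty V›
  have hk : (0 : ℝ) < k := by exact_mod_cast Fin.pos (x v)
  have : Nonempty V := ⟨v⟩
  exact ⟨hk, by rw [div_le_iff₀ hk, mul_comm]; exact one_le_mul_gammaNorm x⟩

end

theorem theorem2 :
    -- 3-Majority, starting from large `γ₀`
    (∃ C A B c : ℝ, 0 < C ∧ 0 < A ∧ 0 < B ∧ 0 < c ∧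
      ∀ (n k : ℕ), 1 ≤ k → k ≤ n →
      ∀ (V : Type u) [Fintype V] [DecidableEq V] [Nonempty V], Fintype.card V = n →
      ∀ x₀ : V → Fin k, C * Real.log n / √(n : ℝ) ≤ gammaNorm x₀ →
        ConsensusWithin.{u, v} threeMajorityStep x₀
          (A * (Real.log n / gammaNorm x₀)) (B * (n : ℝ) ^ (-c))) ∧
    -- 2-Choices, starting from large `γ₀`
    (∃ C A B c : ℝ, 0 < C ∧ 0 < A ∧ 0 < B ∧ 0 < c ∧
      ∀ (n k : ℕ), 1 ≤ k → k ≤ n →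
      ∀ (V : Type u) [Fintype V] [DecidableEq V] [Nonempty V], Fintype.card V = n →
      ∀ x₀ : V → Fin k, C * Real.log n ^ 2 / n ≤ gammaNorm x₀ →
        ConsensusWithin.{u, v} twoChoicesStep x₀
          (A * (Real.log n / gammaNorm x₀)) (B * (n : ℝ) ^ (-c))) ∧
    -- 3-Majority with few opinions
    (∃ A B c : ℝ, 0 < A ∧ 0 < B ∧ 0 < c ∧
      ∀ k : ℕ → ℕ,
      ((fun n : ℕ => (k n : ℝ)) =o[atTop] fun n : ℕ => √(n : ℝ) / Real.log n) →
      ∀ᶠ n : ℕ in atTop,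
      ∀ (V : Type u) [Fintype V] [DecidableEq V] [Nonempty V], Fintype.card V = n →
      ∀ x₀ : V → Fin (k n),
        ConsensusWithin.{u, v} threeMajorityStep x₀
          (A * (k n * Real.log n)) (B * (n : ℝ) ^ (-c))) ∧
    -- 2-Choices with few opinions
    (∃ A B c : ℝ, 0 < A ∧ 0 < B ∧ 0 < c ∧
      ∀ k : ℕ → ℕ,
      ((fun n : ℕ => (k n : ℝ)) =o[atTop] fun n : ℕ => (n : ℝ) / Real.log n ^ 2) →
      ∀ᶠ n : ℕ in atTop,
      ∀ (V : Type u) [Fintype V] [DecidableEq V] [Nonempty V], Fintype.card V = n →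
      ∀ x₀ : V → Fin (k n),
        ConsensusWithin.{u, v} twoChoicesStep x₀
          (A * (k n * Real.log n)) (B * (n : ℝ) ^ (-c))) := by
  -- The little-o hypothesis is used only through `C * k ≤ f` for large `n`, with `C` the constant
  -- of the corresponding bound on `γ₀`; then `γ₀ ≥ 1 / k` meets that bound.
  have few : ∀ (k : ℕ → ℕ) (f : ℕ → ℝ) (C : ℝ), 0 < C → (∀ᶠ n : ℕ in atTop, 0 < f n) →
      (fun n : ℕ => (k n : ℝ)) =o[atTop] f → ∀ᶠ n : ℕ in atTop, C * k n ≤ f n := by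
    intro k f C hC hf hk
    filter_upwards [hf, hk.bound (inv_pos.2 hC)] with n h1 h2
    rw [Real.norm_of_nonneg (Nat.cast_nonneg _), Real.norm_of_nonneg h1.le] at h2
    rwa [le_inv_mul_iff₀ hC] at h2
  have hbig : ∀ᶠ n : ℕ in atTop, 1 ≤ Real.log n :=
    (Real.tendsto_log_atTop.comp tendsto_natCast_atTop_atTop).eventually_ge_atTop 1
  have hpos : ∀ᶠ n : ℕ in atTop, 1 ≤ n := eventually_ge_atTop 1
  refine ⟨⟨100, 130000000, 16384, 1, by norm_num, by norm_num, by norm_num, by norm_num, ?_⟩,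
    ⟨6000, 130000000, 16384, 1, by norm_num, by norm_num, by norm_num, by norm_num, ?_⟩,
    ⟨130000000, 16384, 1, by norm_num, by norm_num, by norm_num, ?_⟩,
    ⟨130000000, 16384, 1, by norm_num, by norm_num, by norm_num, ?_⟩⟩
  · rintro n k - hkn V _ _ _ rfl x₀ hx
    exact consensusWithin_threeMajorityStep hkn x₀ hx
  · rintro n k - hkn V _ _ _ rfl x₀ hx
    exact consensusWithin_twoChoicesStep hkn x₀ hx
  · intro k hk
    have hf : ∀ᶠ n : ℕ in atTop, 0 < √(n : ℝ) / Real.log n := by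
      filter_upwards [hbig, hpos] with n h1 h2
      have : (0 : ℝ) < n := by exact_mod_cast h2
      positivity
    filter_upwards [hbig, hpos, few k _ 100 (by norm_num) hf hk] with n hL hn hkn V _ _ _ hV x₀
    subst hV
    have hn0 : (1 : ℝ) ≤ Fintype.card V := by exact_mod_cast hn
    obtain ⟨hk0, hγ⟩ := inv_le_gammaNorm x₀
    set m : ℝ := (Fintype.card V : ℝ)
    set L := Real.log m
    have hs1 : 1 ≤ √m := Real.one_le_sqrt.2 hn0
    have hss : √m * √m = m := Real.mul_self_sqrt (by linarith)
    rw [le_div_iff₀ (by linarith)] at hkn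
    have hkm : k (Fintype.card V) ≤ Fintype.card V := by
      have : (k (Fintype.card V) : ℝ) ≤ m := by nlinarith
      exact Nat.cast_le.1 this
    refine (consensusWithin_threeMajorityStep hkm x₀ (le_trans ?_ hγ)).mono ?_
    · rw [div_le_div_iff₀ (by linarith) hk0]
      linarith
    · refine mul_le_mul_of_nonneg_left ?_ (by norm_num)
      rw [div_le_iff₀ ((one_div_pos.2 hk0).trans_le hγ)]
      rw [div_le_iff₀ hk0] at hγ
      nlinarith
  · intro k hk
    have hf : ∀ᶠ n : ℕ in atTop, 0 < (n : ℝ) / Real.log n ^ 2 := by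
      filter_upwards [hbig, hpos] with n h1 h2
      have : (0 : ℝ) < n := by exact_mod_cast h2
      positivity
    filter_upwards [hbig, hpos, few k _ 6000 (by norm_num) hf hk] with n hL hn hkn V _ _ _ hV x₀
    subst hV
    have hn0 : (1 : ℝ) ≤ Fintype.card V := by exact_mod_cast hn
    obtain ⟨hk0, hγ⟩ := inv_le_gammaNorm x₀
    set m : ℝ := (Fintype.card V : ℝ)
    set L := Real.log m
    rw [le_div_iff₀ (by positivity)] at hkn
    have hL2 : 1 ≤ L ^ 2 := one_le_pow₀ hL
    have hkm : k (Fintype.card V) ≤ Fintype.card V := by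
      have : (k (Fintype.card V) : ℝ) ≤ m := by nlinarith
      exact Nat.cast_le.1 this
    refine (consensusWithin_twoChoicesStep hkm x₀ (le_trans ?_ hγ)).mono ?_
    · rw [div_le_div_iff₀ (by linarith) hk0]
      linarith
    · refine mul_le_mul_of_nonneg_left ?_ (by norm_num)
      rw [div_le_iff₀ ((one_div_pos.2 hk0).trans_le hγ)]
      rw [div_le_iff₀ hk0] at hγ
      nlinarith
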